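/- Let $K_{n,n}$ be the complete bipartite graph with edge set $N=\{(i,j):1\le i,j\le n\}$, and for integer weights $w^1,\dots,w^d:N\to\mathbb Z$ and a perfect matching $M\subset N$ put $w^k(M):=\sum_{(i,j)\in M}w^k_{i,j}$. The maximum (respectively minimum) nonlinear bipartite matching problem asks, given $n$, $w^1,\dots,w^d$ and a function $f:\mathbb R^d\to\mathbb R$, for a perfect matching $M$ of $K_{n,n}$ that maximizes (respectively minimizes) $f(w^1(M),\dots,w^d(M))$ over all perfect matchings. The function $f$ is presented by a comparison oracle, which, queried on $y,z\in\mathbb Z^d$, asserts whether $f(y)\le f(z)$. **Theorem 1.2.** For every fixed integer $d\ge1$, and for maximization as well as for minimization, there are a randomized algorithm and a polynomial $p$ such that for every positive integer $n$, all integer weights $w^1,\dots,w^d:N\to\mathbb Z$ and every function $f:\mathbb R^d\to\mathbb R$ presented by a comparison oracle, the following hold. Whatever the outcome of its random bits, the algorithm halts within oracle-time at most $p(n,\max_{k,i,j}|w^k_{i,j}|)$ and outputs a perfect matching of $K_{n,n}$; and with probability at least $1/2$ over the random bits this perfect matching is optimal, that is, it solves the nonlinear bipartite matching problem. Here a randomized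 algorithm is a program, depending only on $d$ and on the choice of maximization or minimization, for a random access machine on integers under the logarithmic cost criterion (every operation is charged the bit lengths of the integers involved) that has access to independent fair random bits and to the oracle. The oracle-time is the running time, including the number of random bits used, plus the number of oracle queries. -/

import Mathlib

/-! ## Nonlinear bipartite matching

The edges of the complete bipartite graph on two copies of `Fin n` are the pairs
`(i, j) : Fin n × Fin n`. -/

namespace NonlinearMatching

/-- A set of edges of the complete bipartite graph is a perfect matching if every vertex, on
either side, lies on exactly one of its edges. -/
def IsPerfectMatching {n : ℕ} (M : Finset (Fin n × Fin n)) : Prop :=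
  (∀ i, ∃! j, (i, j) ∈ M) ∧ (∀ j, ∃! i, (i, j) ∈ M)

/-- The vector `(w¹(M), …, wᵈ(M))`, where `wᵏ(M)` is the sum of the weights `wᵏ` of the edges
of `M`. -/
def weight {d n : ℕ} (w : Fin d → Fin n → Fin n → ℤ) (M : Finset (Fin n × Fin n)) :
    Fin d → ℤ :=
  fun k => ∑ e ∈ M, w k e.1 e.2

/-- `max |wᵏ i j|` over all `k`, `i`, `j`. -/
def maxAbs {d n : ℕ} (w : Fin d → Fin n → Fin n → ℤ) : ℕ :=
  Finset.univ.sup fun q : Fin d × Fin n × Fin n => (w q.1 q.2.1 q.2.2).natAbs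

/-- The value of `f : ℝᵈ → ℝ` at an integer point. -/
def atInt {d : ℕ} (f : (Fin d → ℝ) → ℝ) (y : Fin d → ℤ) : ℝ := f fun k => (y k : ℝ)

/-- The two versions of the problem. -/
inductive Goal
  | maximize
  | minimize

/-- `M` is a perfect matching that is optimal for the objective `f (w¹(M), …, wᵈ(M))`. -/
def IsOptimal {d n : ℕ} (goal : Goal) (w : Fin d → Fin n → Fin n → ℤ) (f : (Fin d → ℝ) → ℝ)
    (M : Finset (Fin n × Fin n)) : Prop :=
  IsPerfectMatching M ∧ ∀ M' : Finset (Fin n × Fin n), IsPerfectMatching M' →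
    match goal with
    | .maximize => atInt f (weight w M') ≤ atInt f (weight w M)
    | .minimize => atInt f (weight w M) ≤ atInt f (weight w M')

/-- The comparison oracle presenting `f`: on `y, z ∈ ℤᵈ` it says whether `f y ≤ f z`. -/
def comparisonOracle {d : ℕ} (f : (Fin d → ℝ) → ℝ) (y z : Fin d → ℤ) : Prop :=
  atInt f y ≤ atInt f z

/-! ## Randomized oracle algorithms

The machine model is the random access machine on integers under the logarithmic cost
criterion, with coin tosses and an oracle, programmed by finite structured programs. The memory
consists of integer variables and of integer arrays of unbounded length; the names of the
variables and of the arrays are fixed in the program, the positions in an array are computed. -/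

/-- The contents of the memory, and the number of coins tossed so far. -/
structure State where
  var : ℕ → ℤ
  arr : ℕ → ℤ → ℤ
  coins : ℕ

/-- The operations of the machine. -/
inductive Op
  | add
  | sub
  | mul
  | div
  | mod
  | le
  | eq

/-- `div` and `mod` are quotient and remainder of the division of integers with nonnegative
remainder (the quotient by `0` being `0`); the comparisons give `1` for true and `0` for
false. -/
def Op.apply : Op → ℤ → ℤ → ℤ
  | .add, a, b => a + b
  | .sub, a, b => a - b
  | .mul, a, b => a * b
  | .div, a, b => a / b
  | .mod, a, b => a % b
  | .le, a, b => if a ≤ b then 1 else 0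
  | .eq, a, b => if a = b then 1 else 0

/-- Expressions; `get a i` is the entry of the array `a` at the position given by `i`. -/
inductive Expr
  | const (c : ℤ)
  | var (x : ℕ)
  | get (a : ℕ) (i : Expr)
  | op (o : Op) (e₁ e₂ : Expr)

/-- The value of an expression. -/
def Expr.val (s : State) : Expr → ℤ
  | .const c => c
  | .var x => s.var x
  | .get a i => s.arr a (i.val s)
  | .op o e₁ e₂ => o.apply (e₁.val s) (e₂.val s)

/-- The cost of handling the integer `z`: one more than its number of binary digits. -/
def size (z : ℤ) : ℕ := 1 + Nat.size z.natAbs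

/-- The time to evaluate an expression: the sizes of all numbers that occur in the evaluation,
that is, of all operands, positions and results. -/
def Expr.cost (s : State) : Expr → ℕ
  | .const c => size c
  | .var x => size (s.var x)
  | .get a i => i.cost s + size (s.arr a (i.val s))
  | .op o e₁ e₂ => e₁.cost s + e₂.cost s + size (o.apply (e₁.val s) (e₂.val s))

/-- Programs. -/
inductive Prog
  /-- do nothing -/
  | skip
  /-- `x := e` -/
  | assign (x : ℕ) (e : Expr)
  /-- `a[i] := e` -/
  | store (a : ℕ) (i e : Expr)
  /-- `x :=` a fresh random bit -/
  | toss (x : ℕ)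
  /-- `x := 1` if the oracle affirms the query on `(a[0], …, a[d-1])` and `(b[0], …, b[d-1])`,
  else `x := 0` -/
  | query (x a b : ℕ)
  /-- first `P`, then `Q` -/
  | seq (P Q : Prog)
  /-- `P` if `c` is nonzero, else `Q` -/
  | cond (c : Expr) (P Q : Prog)
  /-- repeat `P` as long as `c` is nonzero -/
  | loop (c : Expr) (P : Prog)

/-- Change the value of one variable. -/
def State.setVar (s : State) (x : ℕ) (v : ℤ) : State :=
  { s with var := Function.update s.var x v }

/-- Change one entry of an array. -/
def State.setArr (s : State) (a : ℕ) (i v : ℤ) : State :=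
  { s with arr := Function.update s.arr a (Function.update (s.arr a) i v) }

/-- The first `d` entries of an array. -/
def State.vec (s : State) (d a : ℕ) : Fin d → ℤ := fun k => s.arr a (k.val : ℤ)

open Classical in
/-- `Exec O ω P s t s'`: with oracle `O` and sequence of coin tosses `ω`, the program `P` started
in state `s` halts in state `s'`, using oracle-time exactly `t`. Besides the cost of its
expressions every command takes one unit of time. A random bit is charged one additional unit,
and so is a query, which is moreover charged the sizes of the numbers that it submits; hence
`t` includes the number of random bits and the number of queries. -/
inductive Exec {d : ℕ} (O : (Fin d → ℤ) → (Fin d → ℤ) → Prop) (ω : ℕ → Bool) :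
    Prog → State → ℕ → State → Prop
  | skip (s : State) : Exec O ω .skip s 1 s
  | assign (x : ℕ) (e : Expr) (s : State) :
      Exec O ω (.assign x e) s (1 + e.cost s) (s.setVar x (e.val s))
  | store (a : ℕ) (i e : Expr) (s : State) :
      Exec O ω (.store a i e) s (1 + i.cost s + e.cost s) (s.setArr a (i.val s) (e.val s))
  | toss (x : ℕ) (s : State) :
      Exec O ω (.toss x) s 2
        { s.setVar x (if ω s.coins = true then 1 else 0) with coins := s.coins + 1 }
  | query (x a b : ℕ) (s : State) :
      Exec O ω (.query x a b) s (2 + ∑ k, size (s.vec d a k) + ∑ k, size (s.vec d b k))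
        (s.setVar x (if O (s.vec d a) (s.vec d b) then 1 else 0))
  | seq {P Q : Prog} {s s' s'' : State} {t t' : ℕ} :
      Exec O ω P s t s' → Exec O ω Q s' t' s'' → Exec O ω (.seq P Q) s (1 + t + t') s''
  | cond_true {c : Expr} {P Q : Prog} {s s' : State} {t : ℕ} : c.val s ≠ 0 →
      Exec O ω P s t s' → Exec O ω (.cond c P Q) s (1 + c.cost s + t) s'
  | cond_false {c : Expr} {P Q : Prog} {s s' : State} {t : ℕ} : c.val s = 0 →
      Exec O ω Q s t s' → Exec O ω (.cond c P Q) s (1 + c.cost s + t) s'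
  | loop_done {c : Expr} {P : Prog} {s : State} : c.val s = 0 →
      Exec O ω (.loop c P) s (1 + c.cost s) s
  | loop_step {c : Expr} {P : Prog} {s s' s'' : State} {t t' : ℕ} : c.val s ≠ 0 →
      Exec O ω P s t s' → Exec O ω (.loop c P) s' t' s'' →
      Exec O ω (.loop c P) s (1 + c.cost s + t + t') s''

/-- For given oracle and coin tosses, the run of a program is unique. -/
theorem Exec.unique {d : ℕ} {O : (Fin d → ℤ) → (Fin d → ℤ) → Prop} {ω : ℕ → Bool} {P : Prog}
    {s s₁ : State} {t₁ : ℕ} (h₁ : Exec O ω P s t₁ s₁) :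
    ∀ {t₂ : ℕ} {s₂ : State}, Exec O ω P s t₂ s₂ → t₁ = t₂ ∧ s₁ = s₂ := by
  induction h₁ with
  | skip | assign | store | toss | query => intro t₂ s₂ h; cases h; exact ⟨rfl, rfl⟩
  | seq _ _ ih ih' =>
    intro t₂ s₂ h
    cases h with
    | seq a b =>
      obtain ⟨rfl, rfl⟩ := ih a
      obtain ⟨rfl, rfl⟩ := ih' b
      exact ⟨rfl, rfl⟩
  | cond_true hc _ ih =>
    intro t₂ s₂ h
    cases h with
    | cond_true _ a => obtain ⟨rfl, rfl⟩ := ih a; exact ⟨rfl, rfl⟩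
    | cond_false hc' _ => exact absurd hc' hc
  | cond_false hc _ ih =>
    intro t₂ s₂ h
    cases h with
    | cond_true hc' _ => exact absurd hc hc'
    | cond_false _ a => obtain ⟨rfl, rfl⟩ := ih a; exact ⟨rfl, rfl⟩
  | loop_done hc =>
    intro t₂ s₂ h
    cases h with
    | loop_done _ => exact ⟨rfl, rfl⟩
    | loop_step hc' _ _ => exact absurd hc hc'
  | loop_step hc _ _ ih ih' =>
    intro t₂ s₂ h
    cases h with
    | loop_done hc' => exact absurd hc' hc
    | loop_step _ a b =>
      obtain ⟨rfl, rfl⟩ := ih a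
      obtain ⟨rfl, rfl⟩ := ih' b
      exact ⟨rfl, rfl⟩

/-- The position at which the weight `wᵏ i j` is stored in the input (all indices are counted
from `0`). -/
def position {d n : ℕ} (q : Fin d × Fin n × Fin n) : ℕ :=
  (q.1.val * n + q.2.1.val) * n + q.2.2.val

/-- The initial state on input `n`, `w`: variable `0` holds `n`, and array `0` holds `wᵏ i j` at
position `(k * n + i) * n + j`; everything else is `0`. -/
def input {d n : ℕ} (w : Fin d → Fin n → Fin n → ℤ) : State where
  var := fun x => if x = 0 then (n : ℤ) else 0
  arr := fun a p =>
    if a = 0 then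
      ∑ q : Fin d × Fin n × Fin n, if p = (position q : ℤ) then w q.1 q.2.1 q.2.2 else 0
    else 0
  coins := 0

/-- Different weights are stored at different positions. -/
theorem position_injective {d n : ℕ} :
    Function.Injective (position : Fin d × Fin n × Fin n → ℕ) := by
  have key : ∀ a b c e : ℕ, c < n → e < n → a * n + c = b * n + e → a = b ∧ c = e := by
    intro a b c e hc he h
    have hn : 0 < n := by omega
    have h1 := congrArg (· / n) h
    have h2 := congrArg (· % n) h
    simp only [mul_comm _ n, Nat.mul_add_div hn, Nat.mul_add_mod, Nat.div_eq_of_lt hc,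
      Nat.div_eq_of_lt he, Nat.mod_eq_of_lt hc, Nat.mod_eq_of_lt he, add_zero] at h1 h2
    exact ⟨h1, h2⟩
  rintro ⟨k, i, j⟩ ⟨k', i', j'⟩ h
  obtain ⟨h1, h2⟩ := key _ _ _ _ j.isLt j'.isLt h
  obtain ⟨h3, h4⟩ := key _ _ _ _ i.isLt i'.isLt h1
  simp only [Prod.mk.injEq]
  exact ⟨Fin.ext h3, Fin.ext h4, Fin.ext h2⟩

/-- The input array holds each weight at its position. -/
theorem input_arr {d n : ℕ} (w : Fin d → Fin n → Fin n → ℤ) (k : Fin d) (i j : Fin n) :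
    (input w).arr 0 (position (k, i, j) : ℤ) = w k i j := by
  have h : ∀ q : Fin d × Fin n × Fin n,
      (((position (k, i, j) : ℕ) : ℤ) = ((position q : ℕ) : ℤ)) ↔ (k, i, j) = q := fun q => by
    rw [Nat.cast_inj, position_injective.eq_iff]
  simp only [input, if_true, h, Finset.sum_ite_eq, Finset.mem_univ]

/-- The set of edges given as output: array `1` holds at position `i` the partner of vertex
`i`. -/
def State.output (s : State) (n : ℕ) : Finset (Fin n × Fin n) :=
  Finset.univ.filter fun e => s.arr 1 (e.1.val : ℤ) = (e.2.val : ℤ)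

/-- The law of a sequence of independent fair coin tosses. -/
noncomputable def coinMeasure : MeasureTheory.Measure (ℕ → Bool) :=
  MeasureTheory.Measure.infinitePi fun _ => (PMF.uniformOfFintype Bool).toMeasure

end NonlinearMatching

open NonlinearMatching

/-!
# Nonlinear bipartite matching by interpolation of a determinant

Shift the weights so that they become nonnegative and write the `d` weights of an edge as the
digits of one number, in a base so large that no carries occur when the `n` edges of a perfect
matching are added (`vecCode`, `decode_permVec`). Since `d` is fixed, these codes are polynomial
in `n` and `max |w|`, and the problem becomes: find out which codes are attained by perfect
matchings, compare the attained vectors by means of the oracle, and find a matching for the best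
one.

To this end a random weight of `O(log n)` bits is added below the code of every edge, which
yields an exponent `c i j` (`edgeCode`), and the matrix with entries `K ^ c i j` is formed. Its
determinant is a sum of signed powers of `K`, one for each perfect matching, and as `K > 2 n!` the
signed number of matchings of any given exponent can be read off as a digit in base `K`
(`digit_signed_sum`, `val_digitExpr`). A nonzero digit certifies that the exponent is attained.
Conversely, among the optimal matchings consider those whose code is least. By the isolation
lemma (`half_le_isolating`), with probability at least `1 / 2` exactly one of them has least
random weight. Its exponent is attained only once, so it has a nonzero digit, and it is the first
exponent at which the search through all nonzero digits meets an optimal vector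
(`SearchInv.eq_first_max`). The edges `(i, j)` of this matching are those for which the same digit
of `K ^ c i j` times the cofactor at `(i, j)` is nonzero (`mul_adjCoeff_zero_pow`,
`edgeCoeff_ne_zero_iff`). The output is always a permutation, being made from the identity by
transpositions, and if the digits describe a matching then it is that matching (`run_output`).

Determinant and cofactors come from the Faddeev–LeVerrier recursion, which needs nothing but
ring operations on integers and exact divisions by `1, …, n`; it follows from
`(X - A) adj (X - A) = χ(X)` and `tr adj (X - A) = χ'(X)` (`adjCoeff_eq`, `trace_adjCoeff`), and
its numbers have polynomially many digits (`abs_adjCoeff_le`).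

The running time is dealt with once and for all: if every loop of a program makes at most `N`
iterations and all stored numbers are at most `R` in absolute value, then the time is at most
`P.steps d N * size R`, where `P.steps d N` is a polynomial in `N` (`Run`, `PolyBdd.steps`). Hence
the proofs about the program keep track of values only, and of these two bounds.
-/

namespace NonlinearMatching

/-! ### Cost of expressions -/

theorem size_pos (z : ℤ) : 0 < size z := by unfold size; omega

theorem size_le_size {a b : ℤ} (h : a.natAbs ≤ b.natAbs) : size a ≤ size b := by
  unfold size; exact Nat.add_le_add_left (Nat.size_le_size h) 1

theorem nat_size_add_le (a b : ℕ) : Nat.size (a + b) ≤ max (Nat.size a) (Nat.size b) + 1 := by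
  rw [Nat.size_le, pow_succ]
  have ha := Nat.lt_size_self a
  have hb := Nat.lt_size_self b
  have ha' := Nat.pow_le_pow_right (n := 2) (by norm_num) (le_max_left a.size b.size)
  have hb' := Nat.pow_le_pow_right (n := 2) (by norm_num) (le_max_right a.size b.size)
  omega

theorem nat_size_mul_le (a b : ℕ) : Nat.size (a * b) ≤ Nat.size a + Nat.size b := by
  rw [Nat.size_le, pow_add]
  exact Nat.mul_lt_mul'' (Nat.lt_size_self a) (Nat.lt_size_self b)

theorem nat_size_pow_le (a m : ℕ) : Nat.size (a ^ m) ≤ m * Nat.size a + 1 := by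
  induction m with
  | zero => simp
  | succ m ih =>
    rw [pow_succ, Nat.succ_mul]
    have := nat_size_mul_le (a ^ m) a
    omega

theorem nat_size_le_self (a : ℕ) : Nat.size a ≤ a :=
  Nat.size_le.2 Nat.lt_two_pow_self

/-- Every operation of the machine increases the number of digits at most additively. -/
theorem size_apply_le (o : Op) (a b : ℤ) : size (o.apply a b) ≤ size a + size b := by
  have hadd : ∀ x y : ℤ, (x.natAbs ≤ a.natAbs) → y.natAbs ≤ b.natAbs →
      size (x + y) ≤ size a + size b := by
    intro x y hx hy
    have h1 : size (x + y) ≤ 1 + Nat.size (a.natAbs + b.natAbs) := by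
      unfold size
      exact Nat.add_le_add_left (Nat.size_le_size (by omega)) 1
    have h2 := nat_size_add_le a.natAbs b.natAbs
    unfold size at *
    omega
  have hbit : ∀ z : ℤ, z = 1 ∨ z = 0 → size z ≤ size a + size b := by
    intro z hz
    have h1 := size_pos a
    have h2 := size_pos b
    have h3 : size z ≤ 2 := by
      rcases hz with rfl | rfl <;> simp [size]
    omega
  cases o with
  | add => exact hadd a b le_rfl le_rfl
  | sub =>
    have := hadd a (-b) le_rfl (by simp)
    simpa [Op.apply, sub_eq_add_neg] using this
  | mul =>
    have := nat_size_mul_le a.natAbs b.natAbs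
    simp only [Op.apply, size, Int.natAbs_mul]
    omega
  | div =>
    have := size_le_size (Int.natAbs_ediv_le_natAbs a b)
    simp only [Op.apply]
    omega
  | mod =>
    simp only [Op.apply]
    by_cases hb : b = 0
    · subst hb; simp
    · have h1 := Int.emod_nonneg a hb
      have h2 := Int.emod_lt_abs a hb
      have := size_le_size (a := a % b) (b := b) (by rw [Int.abs_eq_natAbs] at h2; omega)
      omega
  | le => exact hbit _ (by simp only [Op.apply]; split_ifs <;> simp)
  | eq => exact hbit _ (by simp only [Op.apply]; split_ifs <;> simp)

/-- Length factor of an expression: the value of `e` has at most `e.len` times as many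
digits as the largest number in the memory. -/
def Expr.len : Expr → ℕ
  | .const c => size c
  | .var _ => 1
  | .get _ _ => 1
  | .op _ e₁ e₂ => e₁.len + e₂.len

/-- Cost factor of an expression: the cost of `e` is at most `e.wt` times the size
of the largest number in the memory. -/
def Expr.wt : Expr → ℕ
  | .const c => size c
  | .var _ => 1
  | .get _ i => i.wt + 1
  | .op _ e₁ e₂ => e₁.wt + e₂.wt + (e₁.len + e₂.len)

/-- All numbers in the memory are at most `R` in absolute value. -/
def Bdd (R : ℕ) (s : State) : Prop :=
  (∀ x, |s.var x| ≤ (R : ℤ)) ∧ ∀ a i, |s.arr a i| ≤ (R : ℤ)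

theorem size_le_of_abs_le {z : ℤ} {R : ℕ} (h : |z| ≤ (R : ℤ)) : size z ≤ size R :=
  size_le_size (by rw [Int.abs_eq_natAbs] at h; omega)

theorem Expr.size_val_le {R : ℕ} {s : State} (hs : Bdd R s) (e : Expr) :
    size (e.val s) ≤ e.len * size R := by
  have hR := size_pos (R : ℤ)
  induction e with
  | const c => exact Nat.le_mul_of_pos_right _ hR
  | var x => simpa [Expr.len, Expr.val] using size_le_of_abs_le (hs.1 x)
  | get a i => simpa [Expr.len, Expr.val] using size_le_of_abs_le (hs.2 a _)
  | op o e₁ e₂ h₁ h₂ =>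
    have := size_apply_le o (e₁.val s) (e₂.val s)
    simp only [Expr.val, Expr.len, add_mul]
    omega

theorem Expr.cost_le {R : ℕ} {s : State} (hs : Bdd R s) (e : Expr) :
    e.cost s ≤ e.wt * size R := by
  have hR := size_pos (R : ℤ)
  induction e with
  | const c => exact Nat.le_mul_of_pos_right _ hR
  | var x => simpa [Expr.wt, Expr.cost] using size_le_of_abs_le (hs.1 x)
  | get a i h =>
    have := size_le_of_abs_le (hs.2 a (i.val s))
    simp only [Expr.cost, Expr.wt, add_mul, one_mul]
    omega
  | op o e₁ e₂ h₁ h₂ =>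
    have := (Expr.op o e₁ e₂).size_val_le hs
    simp only [Expr.val, Expr.len, add_mul] at this
    simp only [Expr.cost, Expr.wt, add_mul]
    omega

/-! ### Total correctness with time bounds -/

/-- Time factor of a program: if all loops of `P` make at most `N` iterations and all
numbers are at most `R` in absolute value, then the running time of `P` is at most
`P.steps d N * size R`. -/
def Prog.steps (d N : ℕ) : Prog → ℕ
  | .skip => 1
  | .assign _ e => 1 + e.wt
  | .store _ i e => 1 + i.wt + e.wt
  | .toss _ => 2
  | .query _ _ _ => 2 + d + d
  | .seq P Q => 1 + P.steps d N + Q.steps d N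
  | .cond c P Q => 1 + c.wt + P.steps d N + Q.steps d N
  | .loop c P => (N + 1) * (1 + c.wt + P.steps d N)

/-- The program does not assign to the variable `x`. -/
def Prog.keepsVar (x : ℕ) : Prog → Bool
  | .skip => true
  | .assign y _ => y != x
  | .store _ _ _ => true
  | .toss y => y != x
  | .query y _ _ => y != x
  | .seq P Q => P.keepsVar x && Q.keepsVar x
  | .cond _ P Q => P.keepsVar x && Q.keepsVar x
  | .loop _ P => P.keepsVar x

/-- The program does not write to the array `a`. -/
def Prog.keepsArr (a : ℕ) : Prog → Bool
  | .store b _ _ => b != a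
  | .seq P Q => P.keepsArr a && Q.keepsArr a
  | .cond _ P Q => P.keepsArr a && Q.keepsArr a
  | .loop _ P => P.keepsArr a
  | _ => true

/-- The program does not toss coins. -/
def Prog.keepsCoins : Prog → Bool
  | .toss _ => false
  | .seq P Q => P.keepsCoins && Q.keepsCoins
  | .cond _ P Q => P.keepsCoins && Q.keepsCoins
  | .loop _ P => P.keepsCoins
  | _ => true

@[simp] theorem State.setVar_var (s : State) (x y : ℕ) (v : ℤ) :
    (s.setVar x v).var y = if y = x then v else s.var y := by
  simp [State.setVar, Function.update_apply]

@[simp] theorem State.setVar_arr (s : State) (x : ℕ) (v : ℤ) : (s.setVar x v).arr = s.arr := rfl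

@[simp] theorem State.setVar_coins (s : State) (x : ℕ) (v : ℤ) :
    (s.setVar x v).coins = s.coins := rfl

@[simp] theorem State.setArr_var (s : State) (a : ℕ) (i v : ℤ) :
    (s.setArr a i v).var = s.var := rfl

@[simp] theorem State.setArr_arr (s : State) (a b : ℕ) (i j v : ℤ) :
    (s.setArr a i v).arr b j = if b = a ∧ j = i then v else s.arr b j := by
  by_cases h : b = a
  · subst h; simp [State.setArr, Function.update_apply]
  · simp [State.setArr, h]

theorem State.setArr_arr_of_ne (s : State) {a b : ℕ} (h : b ≠ a) (i v : ℤ) :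
    (s.setArr a i v).arr b = s.arr b := by
  funext j; simp [h]

@[simp] theorem State.setArr_coins (s : State) (a : ℕ) (i v : ℤ) :
    (s.setArr a i v).coins = s.coins := rfl

/-- The states `s` and `s'` agree on everything that `P` does not write to. -/
structure Frame (P : Prog) (s s' : State) : Prop where
  var : ∀ {x : ℕ}, P.keepsVar x = true → s'.var x = s.var x
  arr : ∀ {a : ℕ}, P.keepsArr a = true → s'.arr a = s.arr a
  coins : P.keepsCoins = true → s'.coins = s.coins

theorem Frame.trans {P : Prog} {s s' s'' : State} (h : Frame P s s') (h' : Frame P s' s'') :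
    Frame P s s'' :=
  ⟨fun k => (h'.var k).trans (h.var k), fun k => (h'.arr k).trans (h.arr k),
    fun k => (h'.coins k).trans (h.coins k)⟩

theorem Frame.refl (P : Prog) (s : State) : Frame P s s :=
  ⟨fun _ => rfl, fun _ => rfl, fun _ => rfl⟩

theorem Frame.mono {P Q : Prog} {s s' : State} (h : Frame P s s')
    (hv : ∀ x, Q.keepsVar x = true → P.keepsVar x = true)
    (ha : ∀ a, Q.keepsArr a = true → P.keepsArr a = true)
    (hc : Q.keepsCoins = true → P.keepsCoins = true) : Frame Q s s' :=
  ⟨fun k => h.var (hv _ k), fun k => h.arr (ha _ k), fun k => h.coins (hc k)⟩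

section

variable {d : ℕ} {O : (Fin d → ℤ) → (Fin d → ℤ) → Prop} {ω : ℕ → Bool}

theorem Exec.frame {P : Prog} {s s' : State} {t : ℕ} (h : Exec O ω P s t s') : Frame P s s' := by
  induction h with
  | skip s => exact Frame.refl _ _
  | assign x e s =>
    exact ⟨fun k => by simp [Prog.keepsVar] at k; simp [Ne.symm k], fun _ => rfl, fun _ => rfl⟩
  | store a i e s =>
    exact ⟨fun _ => rfl, fun k => s.setArr_arr_of_ne
      (by simp [Prog.keepsArr] at k; exact Ne.symm k) _ _, fun _ => rfl⟩
  | toss x s =>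
    exact ⟨fun k => by
      simp only [Prog.keepsVar, bne_iff_ne] at k
      rw [State.setVar_var, if_neg (Ne.symm k)], fun _ => rfl, fun k => by
      simp [Prog.keepsCoins] at k⟩
  | query x a b s =>
    exact ⟨fun k => by simp [Prog.keepsVar] at k; simp [Ne.symm k], fun _ => rfl, fun _ => rfl⟩
  | seq _ _ h h' =>
    refine (h.mono ?_ ?_ ?_).trans (h'.mono ?_ ?_ ?_) <;>
      simp +contextual [Prog.keepsVar, Prog.keepsArr, Prog.keepsCoins]
  | cond_true _ _ h | cond_false _ _ h =>
    refine (h.mono ?_ ?_ ?_) <;>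
      simp +contextual [Prog.keepsVar, Prog.keepsArr, Prog.keepsCoins]
  | loop_done _ => exact Frame.refl _ _
  | loop_step _ _ _ h h' =>
    refine (h.mono ?_ ?_ ?_).trans h' <;> simp [Prog.keepsVar, Prog.keepsArr, Prog.keepsCoins]

variable (O ω) in
/-- Started in a state whose numbers are bounded by `R`, the program `P` halts within time
`P.steps d N * size R` in a state with property `Q` whose numbers are bounded by `R`. -/
def Run (N R : ℕ) (P : Prog) (s : State) (Q : State → Prop) : Prop :=
  Bdd R s → ∃ (t : ℕ) (s' : State), Exec O ω P s t s' ∧ t ≤ P.steps d N * size R ∧ Bdd R s' ∧ Q s'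

variable {N R : ℕ} {P P' : Prog} {s : State} {Q Q' : State → Prop}

theorem Bdd.setVar {s : State} (hs : Bdd R s) {v : ℤ} (hv : |v| ≤ (R : ℤ)) (x : ℕ) :
    Bdd R (s.setVar x v) := by
  refine ⟨fun y => ?_, hs.2⟩
  rw [State.setVar_var]
  split_ifs
  exacts [hv, hs.1 y]

theorem Bdd.setArr {s : State} (hs : Bdd R s) {v : ℤ} (hv : |v| ≤ (R : ℤ)) (a : ℕ) (i : ℤ) :
    Bdd R (s.setArr a i v) := by
  refine ⟨hs.1, fun b j => ?_⟩
  rw [State.setArr_arr]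
  split_ifs
  exacts [hv, hs.2 b j]

/-- The consequence rule, which also supplies the frame condition. -/
theorem Run.mono (h : Run O ω N R P s Q) (hQ : ∀ s', Frame P s s' → Bdd R s' → Q s' → Q' s') :
    Run O ω N R P s Q' := fun hs => by
  obtain ⟨t, s', he, ht, hb, hq⟩ := h hs
  exact ⟨t, s', he, ht, hb, hQ s' he.frame hb hq⟩

theorem Run.skip (h : Q s) : Run O ω N R .skip s Q := fun hs =>
  ⟨_, _, .skip s, by simpa [Prog.steps] using Nat.succ_le_of_lt (size_pos (R : ℤ)), hs, h⟩

theorem Run.assign {x : ℕ} {e : Expr} (hb : |e.val s| ≤ (R : ℤ)) (h : Q (s.setVar x (e.val s))) :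
    Run O ω N R (.assign x e) s Q := fun hs => by
  refine ⟨_, _, .assign x e s, ?_, hs.setVar hb x, h⟩
  have := size_pos (R : ℤ)
  have := e.cost_le hs
  simp only [Prog.steps, add_mul]
  omega

theorem Run.store {a : ℕ} {i e : Expr} (hb : |e.val s| ≤ (R : ℤ))
    (h : Q (s.setArr a (i.val s) (e.val s))) : Run O ω N R (.store a i e) s Q := fun hs => by
  refine ⟨_, _, .store a i e s, ?_, hs.setArr hb a _, h⟩
  have := size_pos (R : ℤ)
  have := e.cost_le hs
  have := i.cost_le hs
  simp only [Prog.steps, add_mul]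
  omega

/-- `Run.assign` for a value that is known to be the integer `v`. -/
theorem Run.assign_eq {x : ℕ} {e : Expr} (v : ℤ) (hv : e.val s = v) (hb : |v| ≤ (R : ℤ))
    (h : Q (s.setVar x v)) : Run O ω N R (.assign x e) s Q := by
  subst hv; exact Run.assign hb h

/-- `Run.assign` for a value that is known to be the natural number `v`. -/
theorem Run.assign_nat {x : ℕ} {e : Expr} (v : ℕ) (hv : e.val s = v) (hb : v ≤ R)
    (h : Q (s.setVar x v)) : Run O ω N R (.assign x e) s Q :=
  Run.assign_eq v hv (by rwa [Nat.abs_cast, Nat.cast_le]) h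

/-- `Run.store` for a position and a value that are known. -/
theorem Run.store_eq {a : ℕ} {i e : Expr} (p v : ℤ) (hp : i.val s = p) (hv : e.val s = v)
    (hb : |v| ≤ (R : ℤ)) (h : Q (s.setArr a p v)) : Run O ω N R (.store a i e) s Q := by
  subst hp hv; exact Run.store hb h

theorem Run.toss {x : ℕ} (hR : 1 ≤ R)
    (h : Q { s.setVar x (if ω s.coins = true then 1 else 0) with coins := s.coins + 1 }) :
    Run O ω N R (.toss x) s Q := fun hs => by
  refine ⟨_, _, .toss x s, ?_, hs.setVar (v := if ω s.coins = true then 1 else 0) ?_ x, h⟩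
  · have := size_pos (R : ℤ)
    simp only [Prog.steps]
    omega
  · split_ifs <;> simp [hR]

open Classical in
theorem Run.query {x a b : ℕ} (hR : 1 ≤ R)
    (h : Q (s.setVar x (if O (s.vec d a) (s.vec d b) then 1 else 0))) :
    Run O ω N R (.query x a b) s Q := fun hs => by
  refine ⟨_, _, .query x a b s, ?_,
    hs.setVar (v := if O (s.vec d a) (s.vec d b) then 1 else 0) ?_ x, h⟩
  · have h1 := size_pos (R : ℤ)
    have h2 : ∀ c, ∑ k, size (s.vec d c k) ≤ d * size R := fun c => by
      simpa using Finset.sum_le_card_nsmul Finset.univ (fun k => size (s.vec d c k)) (size R)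
        fun k _ => size_le_of_abs_le (hs.2 c _)
    have h3 := h2 a
    have h4 := h2 b
    simp only [Prog.steps, add_mul]
    omega
  · split_ifs <;> simp [hR]

theorem Run.seq (h : Run O ω N R P s fun s' => Run O ω N R P' s' Q) :
    Run O ω N R (.seq P P') s Q := fun hs => by
  obtain ⟨t, s', he, ht, hb, hq⟩ := h hs
  obtain ⟨t', s'', he', ht', hb', hq'⟩ := hq hb
  refine ⟨_, _, .seq he he', ?_, hb', hq'⟩
  have := size_pos (R : ℤ)
  simp only [Prog.steps, add_mul]
  omega

theorem Run.cond {c : Expr} (h : c.val s ≠ 0 → Run O ω N R P s Q)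
    (h' : c.val s = 0 → Run O ω N R P' s Q) : Run O ω N R (.cond c P P') s Q := fun hs => by
  have := size_pos (R : ℤ)
  have := c.cost_le hs
  by_cases hc : c.val s = 0
  · obtain ⟨t, s', he, ht, hb, hq⟩ := h' hc hs
    refine ⟨_, _, .cond_false hc he, ?_, hb, hq⟩
    simp only [Prog.steps, add_mul]
    omega
  · obtain ⟨t, s', he, ht, hb, hq⟩ := h hc hs
    refine ⟨_, _, .cond_true hc he, ?_, hb, hq⟩
    simp only [Prog.steps, add_mul]
    omega

/-- `for x = 0, 1, …, y - 1 do P`. -/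
def Prog.for (x y : ℕ) (P : Prog) : Prog :=
  .seq (.assign x (.const 0)) <| .loop (.op .le (.op .add (.var x) (.const 1)) (.var y)) <|
    .seq P (.assign x (.op .add (.var x) (.const 1)))

/-- The invariant rule for counting loops. In the conclusion of the step the loop counter is already
increased, as the invariant may mention it. -/
theorem Run.for {x y m : ℕ} (I : ℕ → State → Prop) (hm : s.var y = m) (hN : m ≤ N) (hR : m ≤ R)
    (hx : P.keepsVar x = true) (hy : P.keepsVar y = true) (hxy : y ≠ x)
    (h0 : I 0 (s.setVar x 0))
    (hstep : ∀ k < m, ∀ s', Frame (.for x y P) s s' → s'.var x = k → I k s' →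
      Run O ω N R P s' fun s'' => I (k + 1) (s''.setVar x ((k : ℤ) + 1))) :
    Run O ω N R (.for x y P) s (I m) := by
  refine Run.seq (Run.assign (by simp [Expr.val]) ?_)
  set c : Expr := .op .le (.op .add (.var x) (.const 1)) (.var y) with hc
  set body : Prog := .seq P (.assign x (.op .add (.var x) (.const 1))) with hbody
  -- downward induction on the counter, the time being proportional to the remaining iterations
  have key : ∀ r k, k + r = m → ∀ s', Frame (.for x y P) s s' → s'.var x = k → I k s' →
      Bdd R s' → ∃ t s'', Exec O ω (.loop c body) s' t s'' ∧
        t ≤ (r + 1) * (1 + c.wt + body.steps d N) * size R ∧ Bdd R s'' ∧ I m s'' := by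
    intro r
    induction r with
    | zero =>
      intro k hk s' hf hkx hI hs'
      obtain rfl : k = m := by omega
      have hyv : s'.var y = k := by
        rw [hf.var, hm]
        simp [Prog.for, Prog.keepsVar, hy, Ne.symm hxy]
      have hcv : c.val s' = 0 := by simp [hc, Expr.val, Op.apply, hkx, hyv]
      refine ⟨_, _, .loop_done hcv, ?_, hs', hI⟩
      have := size_pos (R : ℤ)
      have := c.cost_le hs'
      simp only [add_mul, one_mul, zero_add]
      omega
    | succ r ih =>
      intro k hk s' hf hkx hI hs'
      have hyv : s'.var y = m := by
        rw [hf.var, hm]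
        simp [Prog.for, Prog.keepsVar, hy, Ne.symm hxy]
      have hcv : c.val s' ≠ 0 := by
        simp [hc, Expr.val, Op.apply, hkx, hyv]; omega
      have hb : Run O ω N R body s' fun s'' => s''.var x = ((k + 1 : ℕ) : ℤ) ∧ I (k + 1) s'' := by
        refine Run.seq ((hstep k (by omega) s' hf hkx hI).mono fun s'' hf' _ hI' => ?_)
        have hv : s''.var x = k := by rw [hf'.var hx, hkx]
        refine Run.assign ?_ ?_
        · simp only [Expr.val, Op.apply, hv]
          rw [abs_of_nonneg (by omega)]; omega
        · simp only [Expr.val, Op.apply, hv]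
          exact ⟨by simp, hI'⟩
      obtain ⟨t, s₁, he, ht, hb₁, hv₁, hI₁⟩ := hb hs'
      have hf₁ : Frame (.for x y P) s s₁ := hf.trans (he.frame.mono
        (by simp +contextual [hbody, Prog.for, Prog.keepsVar])
        (by simp +contextual [hbody, Prog.for, Prog.keepsArr])
        (by simp +contextual [hbody, Prog.for, Prog.keepsCoins]))
      obtain ⟨t', s₂, he', ht', hb₂, hI₂⟩ := ih (k + 1) (by omega) s₁ hf₁ hv₁ hI₁ hb₁
      refine ⟨_, _, .loop_step hcv he he', ?_, hb₂, hI₂⟩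
      have := size_pos (R : ℤ)
      have := c.cost_le hs'
      have e1 : (r + 1 + 1) * (1 + c.wt + body.steps d N) * size R =
        (r + 1) * (1 + c.wt + body.steps d N) * size R +
          (size R + c.wt * size R + body.steps d N * size R) := by ring
      omega
  intro hs
  have hf0 : Frame (.for x y P) s (s.setVar x 0) :=
    ⟨fun {z} k => by
      have : z ≠ x := by rintro rfl; simp [Prog.for, Prog.keepsVar] at k
      simp [this], fun _ => rfl, fun _ => rfl⟩
  obtain ⟨t, s', he, ht, hb, hI⟩ := key m 0 (by omega) _ hf0 (by simp) h0 hs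
  refine ⟨t, s', he, ht.trans (Nat.mul_le_mul_right _ ?_), hb, hI⟩
  simp only [Prog.steps]
  exact Nat.mul_le_mul_right _ (by omega)

end

/-! ### Polynomial bounds -/

/-- `F` is bounded by a polynomial in two variables. -/
def PolyBdd (F : ℕ → ℕ → ℕ) : Prop :=
  ∃ p : MvPolynomial (Fin 2) ℕ, ∀ a b, F a b ≤ MvPolynomial.eval ![a, b] p

namespace PolyBdd

variable {F G : ℕ → ℕ → ℕ}

theorem const (c : ℕ) : PolyBdd fun _ _ => c := ⟨MvPolynomial.C c, by simp⟩

theorem fst : PolyBdd fun a _ => a := ⟨MvPolynomial.X 0, by simp⟩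

theorem snd : PolyBdd fun _ b => b := ⟨MvPolynomial.X 1, by simp⟩

theorem add (hF : PolyBdd F) (hG : PolyBdd G) : PolyBdd fun a b => F a b + G a b := by
  obtain ⟨p, hp⟩ := hF
  obtain ⟨q, hq⟩ := hG
  exact ⟨p + q, fun a b => by simpa using Nat.add_le_add (hp a b) (hq a b)⟩

theorem mul (hF : PolyBdd F) (hG : PolyBdd G) : PolyBdd fun a b => F a b * G a b := by
  obtain ⟨p, hp⟩ := hF
  obtain ⟨q, hq⟩ := hG
  exact ⟨p * q, fun a b => by simpa using Nat.mul_le_mul (hp a b) (hq a b)⟩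

theorem pow (hF : PolyBdd F) (k : ℕ) : PolyBdd fun a b => F a b ^ k := by
  obtain ⟨p, hp⟩ := hF
  exact ⟨p ^ k, fun a b => by simpa using Nat.pow_le_pow_left (hp a b) k⟩

theorem steps (hF : PolyBdd F) (d : ℕ) (P : Prog) : PolyBdd fun a b => P.steps d (F a b) := by
  induction P with
  | skip | assign | store | toss | query => exact const _
  | seq P Q h h' => exact ((const 1).add h).add h'
  | cond c P Q h h' => exact ((const _).add h).add h'
  | loop c P h => exact (hF.add (const 1)).mul ((const _).add h)

end PolyBdd

/-! ### The Faddeev–LeVerrier recursion -/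

section FaddeevLeVerrier

open Polynomial Matrix

variable {n : ℕ}

theorem derivative_det {R : Type*} [CommRing R] (M : Matrix (Fin n) (Fin n) R[X]) :
    derivative M.det = ∑ i, (M.updateRow i fun j => derivative (M i j)).det := by
  have hdet : ∀ N : Matrix (Fin n) (Fin n) R[X],
      N.det = ∑ σ : Equiv.Perm (Fin n), ((σ.sign : ℤ) : R[X]) * ∏ i, N i (σ i) := fun N => by
    rw [← det_transpose, det_apply']; rfl
  rw [hdet, derivative_sum]
  simp_rw [hdet]
  rw [Finset.sum_comm]
  refine Finset.sum_congr rfl fun σ _ => ?_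
  rw [derivative_mul, derivative_intCast, zero_mul,
    zero_add, derivative_prod_finset, ← Finset.mul_sum]
  congr 1
  refine Finset.sum_congr rfl fun i _ => ?_
  rw [← Finset.prod_erase_mul _ _ (Finset.mem_univ i), updateRow_self]
  congr 1
  refine Finset.prod_congr rfl fun l hl => ?_
  rw [updateRow_ne (Finset.ne_of_mem_erase hl)]

/-- Since the derivative of `X - A` is the identity, the product rule gives the trace of the
adjugate. -/
theorem derivative_charpoly {R : Type*} [CommRing R] (A : Matrix (Fin n) (Fin n) R) :
    derivative A.charpoly = (adjugate (charmatrix A)).trace := by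
  rw [charpoly, derivative_det, trace]
  refine Finset.sum_congr rfl fun i _ => ?_
  rw [diag_apply, adjugate_apply]
  congr 2
  funext j
  by_cases h : i = j
  · subst h; simp [charmatrix_apply_eq]
  · simp [charmatrix_apply_ne _ _ _ h, Ne.symm h]

/-- The matrix coefficient of `X ^ k` in the adjugate of `X - A`. -/
noncomputable def adjCoeff (A : Matrix (Fin n) (Fin n) ℤ) (k : ℕ) : Matrix (Fin n) (Fin n) ℤ :=
  (adjugate (charmatrix A)).map fun p => p.coeff k

variable (A : Matrix (Fin n) (Fin n) ℤ)

theorem charmatrix_mul_adjugate (i j : Fin n) :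
    X * adjugate (charmatrix A) i j - ∑ l, C (A i l) * adjugate (charmatrix A) l j =
      if i = j then A.charpoly else 0 := by
  have h := congrFun (congrFun (mul_adjugate (charmatrix A)) i) j
  rw [charmatrix, sub_mul, Matrix.sub_apply, Matrix.smul_apply, one_apply, ← charmatrix] at h
  simpa [mul_apply, charpoly, diagonal_apply] using h

/-- Comparing coefficients in `(X - A) adj (X - A) = χ(X)`. -/
theorem adjCoeff_eq (k : ℕ) :
    adjCoeff A k = A * adjCoeff A (k + 1) + A.charpoly.coeff (k + 1) • 1 := by
  ext i j
  have h := congrArg (fun p => p.coeff (k + 1)) (charmatrix_mul_adjugate A i j)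
  simp only [coeff_sub, coeff_X_mul, finsetSum_coeff, coeff_C_mul] at h
  simp only [adjCoeff, Matrix.add_apply, mul_apply, map_apply, Matrix.smul_apply, one_apply]
  rw [sub_eq_iff_eq_add] at h
  rw [h, add_comm]
  split_ifs <;> simp

theorem mul_adjCoeff_zero : A * adjCoeff A 0 + A.charpoly.coeff 0 • 1 = 0 := by
  ext i j
  have h := congrArg (fun p => p.coeff 0) (charmatrix_mul_adjugate A i j)
  simp only [coeff_sub, mul_coeff_zero, coeff_X_zero, zero_mul, finsetSum_coeff,
    zero_sub, coeff_C_zero] at h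
  simp only [adjCoeff, Matrix.add_apply, mul_apply, map_apply, Matrix.smul_apply, one_apply,
    Matrix.zero_apply]
  rw [neg_eq_iff_eq_neg] at h
  rw [h]
  split_ifs <;> simp

theorem trace_adjCoeff (k : ℕ) :
    (adjCoeff A k).trace = (k + 1 : ℤ) * A.charpoly.coeff (k + 1) := by
  have h := congrArg (fun p => p.coeff k) (derivative_charpoly A)
  simp only [coeff_derivative] at h
  rw [mul_comm, h]
  simp [adjCoeff, trace]

/-- The coefficients of the characteristic polynomial, recursively from the top. -/
theorem charpoly_coeff_mul {k m : ℕ} (h : k + m = n) :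
    (m : ℤ) * A.charpoly.coeff k = -(A * adjCoeff A k).trace := by
  have hn : (n : ℤ) = k + m := by omega
  cases k with
  | zero =>
    have := congrArg trace (mul_adjCoeff_zero A)
    rw [trace_add, trace_smul, trace_one, Fintype.card_fin, hn, trace_zero] at this
    push_cast [smul_eq_mul] at this
    linarith
  | succ k =>
    have := congrArg trace (adjCoeff_eq A k)
    rw [trace_add, trace_smul, trace_one, Fintype.card_fin, hn, trace_adjCoeff] at this
    push_cast [smul_eq_mul] at this
    linarith

theorem charpoly_coeff_card : A.charpoly.coeff n = 1 := by
  simpa using (charpoly_monic A).coeff_natDegree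

/-- The coefficient matrices satisfy `B k = A * B (k + 1)` for `k ≥ n`, and almost all of them
vanish. -/
theorem adjCoeff_card : adjCoeff A n = 0 := by
  have h : ∀ j k, n ≤ k → adjCoeff A k = A ^ j * adjCoeff A (k + j) := by
    intro j k hk
    induction j with
    | zero => simp
    | succ j ih =>
      have h0 : A.charpoly.coeff (k + j + 1) = 0 :=
        coeff_eq_zero_of_natDegree_lt (by rw [charpoly_natDegree_eq_dim, Fintype.card_fin]; omega)
      rw [ih, adjCoeff_eq A (k + j), h0, zero_smul, add_zero, pow_succ, Matrix.mul_assoc, add_assoc]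
  let J := ∑ i, ∑ j, ((adjugate (charmatrix A)) i j).natDegree
  have h0 : adjCoeff A (n + (J + 1)) = 0 := by
    ext i j
    change ((adjugate (charmatrix A)) i j).coeff _ = 0
    refine coeff_eq_zero_of_natDegree_lt ?_
    have h1 : ((adjugate (charmatrix A)) i j).natDegree ≤
        ∑ j, ((adjugate (charmatrix A)) i j).natDegree :=
      Finset.single_le_sum (f := fun j => ((adjugate (charmatrix A)) i j).natDegree)
        (fun _ _ => Nat.zero_le _) (Finset.mem_univ j)
    have h2 : ∑ j, ((adjugate (charmatrix A)) i j).natDegree ≤ J :=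
      Finset.single_le_sum (f := fun i => ∑ j, ((adjugate (charmatrix A)) i j).natDegree)
        (fun _ _ => Nat.zero_le _) (Finset.mem_univ i)
    omega
  rw [h (J + 1) n le_rfl, h0, Matrix.mul_zero]

theorem charpoly_coeff_zero : A.charpoly.coeff 0 = (-A).det := by
  rw [coeff_zero_eq_eval_zero, eval_charpoly]
  simp

theorem adjCoeff_zero : adjCoeff A 0 = adjugate (-A) := by
  have h := RingHom.map_adjugate (evalRingHom (0 : ℤ)) (charmatrix A)
  have h2 : (evalRingHom (0 : ℤ)).mapMatrix (charmatrix A) = -A := by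
    ext i j
    by_cases hij : i = j
    · subst hij; simp [charmatrix_apply_eq]
    · simp [charmatrix_apply_ne _ _ _ hij]
  rw [h2] at h
  rw [← h]
  ext i j
  simp [adjCoeff, coeff_zero_eq_eval_zero]

/-- The terms of the Leibniz formula for `det N` that contain the entry at `(i, j)`. -/
theorem mul_adjugate_apply_eq_sum (N : Matrix (Fin n) (Fin n) ℤ) (i j : Fin n) :
    N i j * adjugate N j i =
      ∑ σ : Equiv.Perm (Fin n) with σ i = j, (σ.sign : ℤ) * ∏ l, N l (σ l) := by
  rw [adjugate_apply, ← det_updateRow_smul, ← det_transpose, det_apply', Finset.sum_filter]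
  refine Finset.sum_congr rfl fun σ _ => ?_
  simp only [transpose_apply]
  split_ifs with h
  · congr 1
    refine Finset.prod_congr rfl fun l _ => ?_
    by_cases hl : l = i
    · subst hl; subst h; simp
    · rw [updateRow_ne hl]
  · rw [Finset.prod_eq_zero (Finset.mem_univ i), mul_zero]
    simp [h]

/-- The sign with which a permutation occurs in the Leibniz formula for `det (-A)`. -/
def signNeg (σ : Equiv.Perm (Fin n)) : ℤ := (-1) ^ n * σ.sign

theorem abs_signNeg (σ : Equiv.Perm (Fin n)) : |signNeg σ| = 1 := by
  rw [signNeg, abs_mul, abs_pow, abs_neg, abs_one, one_pow, one_mul]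
  rcases Int.units_eq_one_or σ.sign with h | h <;> simp [h]

theorem sign_mul_prod_neg_pow (K : ℤ) (c : Fin n → Fin n → ℕ) (σ : Equiv.Perm (Fin n)) :
    (σ.sign : ℤ) * ∏ l, (-of fun i j => K ^ c i j) l (σ l) =
      signNeg σ * K ^ ∑ i, c i (σ i) := by
  simp only [Matrix.neg_apply, of_apply, Finset.prod_neg, Finset.card_univ, Fintype.card_fin,
    signNeg, Finset.prod_pow_eq_pow_sum]
  ring

/-- For a matrix of powers of `K` the constant coefficient of the characteristic polynomial is a
sum of signed powers of `K`, one for each perfect matching. -/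
theorem charpoly_coeff_zero_pow (K : ℤ) (c : Fin n → Fin n → ℕ) :
    (of fun i j => K ^ c i j).charpoly.coeff 0 =
      ∑ σ : Equiv.Perm (Fin n), signNeg σ * K ^ ∑ i, c i (σ i) := by
  rw [charpoly_coeff_zero, ← det_transpose, det_apply']
  exact Finset.sum_congr rfl fun σ _ => sign_mul_prod_neg_pow K c σ

/-- An entry times its cofactor is the part of the same sum, up to a common sign, that belongs to
the perfect matchings through this entry. -/
theorem mul_adjCoeff_zero_pow (K : ℤ) (c : Fin n → Fin n → ℕ) (i j : Fin n) :
    K ^ c i j * adjCoeff (of fun i j => K ^ c i j) 0 j i =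
      ∑ σ : Equiv.Perm (Fin n) with σ i = j, -signNeg σ * K ^ ∑ i, c i (σ i) := by
  have h := mul_adjugate_apply_eq_sum (-of fun i j => K ^ c i j) i j
  rw [Finset.sum_congr rfl fun σ _ => sign_mul_prod_neg_pow K c σ, Matrix.neg_apply, of_apply,
    neg_mul, neg_eq_iff_eq_neg] at h
  rw [adjCoeff_zero, h, ← Finset.sum_neg_distrib]
  exact Finset.sum_congr rfl fun σ _ => by ring

/-- One step of the recursion multiplies the size of the entries by a bounded factor. -/
theorem abs_adjCoeff_le {a : ℤ} (ha : 1 ≤ a) (hA : ∀ i j, |A i j| ≤ a) (hn : 0 < n) :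
    ∀ m k, k + m = n → (∀ i j, |adjCoeff A k i j| ≤ (2 * n ^ 3 * a ^ 2) ^ m) ∧
      |A.charpoly.coeff k| ≤ (2 * n ^ 3 * a ^ 2) ^ m := by
  have hn1 : (1 : ℤ) ≤ n := by omega
  have hmul : ∀ (B : Matrix (Fin n) (Fin n) ℤ) (β : ℤ), (∀ i j, |B i j| ≤ β) →
      ∀ i j, |(A * B) i j| ≤ n * (a * β) := by
    intro B β hB i j
    rw [mul_apply]
    refine (Finset.abs_sum_le_sum_abs _ _).trans ?_
    refine (Finset.sum_le_card_nsmul _ _ (a * β) fun l _ => ?_).trans (by simp)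
    rw [abs_mul]
    exact mul_le_mul (hA _ _) (hB _ _) (abs_nonneg _) (by omega)
  intro m
  induction m with
  | zero =>
    intro k hk
    obtain rfl : k = n := by omega
    simp [adjCoeff_card, charpoly_coeff_card]
  | succ m ih =>
    intro k hk
    obtain ⟨h1, h2⟩ := ih (k + 1) (by omega)
    set β := (2 * (n : ℤ) ^ 3 * a ^ 2) ^ m with hβ
    have hβ0 : 1 ≤ β := one_le_pow₀ (by
      have := mul_le_mul (one_le_pow₀ hn1 (n := 3)) (one_le_pow₀ ha (n := 2)) (by norm_num)
        (by positivity)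
      linarith)
    have hB : ∀ i j, |adjCoeff A k i j| ≤ 2 * n * a * β := by
      intro i j
      rw [adjCoeff_eq, Matrix.add_apply]
      refine (abs_add_le _ _).trans ?_
      have e1 := hmul _ _ h1 i j
      have e2 : |(A.charpoly.coeff (k + 1) • (1 : Matrix (Fin n) (Fin n) ℤ)) i j| ≤ β := by
        rw [Matrix.smul_apply, one_apply]
        split_ifs
        · simpa using h2
        · simp; omega
      have e3 : 1 * β ≤ (n * a) * β :=
        mul_le_mul_of_nonneg_right (by nlinarith) (by omega)
      linarith
    have hna : (1 : ℤ) ≤ n * a := by nlinarith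
    rw [pow_succ, ← hβ]
    constructor
    · intro i j
      refine (hB i j).trans ?_
      have : 2 * n * a * β ≤ (2 * n * a * β) * (n ^ 2 * a) :=
        le_mul_of_one_le_right (by positivity) (by
          have := mul_le_mul (one_le_pow₀ hn1 (n := 2)) ha (by norm_num) (by positivity)
          linarith)
      linarith
    · have e1 := charpoly_coeff_mul A hk
      have e2 : |(A * adjCoeff A k).trace| ≤ n * (n * (a * (2 * n * a * β))) := by
        rw [trace]
        refine (Finset.abs_sum_le_sum_abs _ _).trans ?_
        refine (Finset.sum_le_card_nsmul _ _ _ fun l _ => ?_).trans (by simp; rfl)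
        exact hmul _ _ hB l l
      have e3 : |((m + 1 : ℕ) : ℤ) * A.charpoly.coeff k| ≤ n * (n * (a * (2 * n * a * β))) := by
        rw [e1, abs_neg]; exact e2
      rw [abs_mul, abs_of_nonneg (by positivity : (0 : ℤ) ≤ ((m + 1 : ℕ) : ℤ))] at e3
      have e4 : |A.charpoly.coeff k| ≤ ((m + 1 : ℕ) : ℤ) * |A.charpoly.coeff k| :=
        le_mul_of_one_le_left (abs_nonneg _) (by push_cast; omega)
      refine e4.trans (e3.trans (le_of_eq (by ring)))

end FaddeevLeVerrier

/-! ### Digits -/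

/-- A number with `m` digits in base `K` is less than `K ^ m`. -/
theorem sum_digits_lt {K : ℤ} {a : ℕ → ℤ} {m : ℕ} (ha : ∀ i < m, 0 ≤ a i ∧ a i < K) :
    0 ≤ ∑ i ∈ Finset.range m, a i * K ^ i ∧ ∑ i ∈ Finset.range m, a i * K ^ i < K ^ m := by
  induction m with
  | zero => simp
  | succ m ih =>
    have ham := ha m (Nat.lt_succ_self m)
    have hK : 0 < K := ham.1.trans_lt ham.2
    have hp : 0 < K ^ m := by positivity
    obtain ⟨h1, h2⟩ := ih fun i hi => ha i (hi.trans (Nat.lt_succ_self m))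
    rw [Finset.sum_range_succ, pow_succ]
    have h3 := mul_nonneg ham.1 hp.le
    have h4 : (a m + 1) * K ^ m ≤ K * K ^ m :=
      mul_le_mul_of_nonneg_right (by omega) hp.le
    constructor <;> nlinarith

/-- Division with remainder recovers the digits of a number. -/
theorem digit_sum {K : ℤ} {C c : ℕ} (a : ℕ → ℤ) (ha : ∀ i < C, 0 ≤ a i ∧ a i < K) (hc : c < C) :
    (∑ i ∈ Finset.range C, a i * K ^ i) / K ^ c % K = a c := by
  have hK : 0 < K := (ha c hc).1.trans_lt (ha c hc).2
  have hlow := sum_digits_lt fun i hi => ha i (hi.trans hc)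
  obtain ⟨r, rfl⟩ : ∃ r, C = c + 1 + r := ⟨C - (c + 1), by omega⟩
  rw [Finset.sum_range_add, Finset.sum_range_succ]
  have h : ∑ i ∈ Finset.range r, a (c + 1 + i) * K ^ (c + 1 + i) =
      K ^ c * (K * ∑ i ∈ Finset.range r, a (c + 1 + i) * K ^ i) := by
    simp only [Finset.mul_sum]
    exact Finset.sum_congr rfl fun i _ => by ring
  have hp : 0 < K ^ c := by positivity
  rw [h, mul_comm (a c), add_assoc, ← mul_add, Int.add_mul_ediv_left _ _ hp.ne',
    Int.ediv_eq_zero_of_lt hlow.1 hlow.2, zero_add, Int.add_mul_emod_self_left,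
    Int.emod_eq_of_lt (ha c hc).1 (ha c hc).2]

/-- Balanced digits: a sum of signed powers of `K = 2 h + 1` whose coefficients are at most `h`
in absolute value becomes an ordinary expansion in base `K` after adding `(K ^ C - 1) / 2`, all of
whose digits are `h`. -/
theorem digit_signed_sum {ι : Type*} (S : Finset ι) (e : ι → ℤ) (c : ι → ℕ) {h C : ℕ}
    (hS : S.card ≤ h) (he : ∀ x ∈ S, |e x| ≤ 1) (hc : ∀ x ∈ S, c x < C) {m : ℕ} (hm : m < C) :
    ((∑ x ∈ S, e x * (2 * h + 1 : ℤ) ^ c x) + (2 * h + 1 : ℤ) ^ C / 2) / (2 * h + 1 : ℤ) ^ m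
      % (2 * h + 1 : ℤ) = h + ∑ x ∈ S with c x = m, e x := by
  set K : ℤ := 2 * h + 1 with hK
  have hhalf : K ^ C / 2 = ∑ i ∈ Finset.range C, (h : ℤ) * K ^ i := by
    have := geom_sum_mul K C
    rw [← Finset.mul_sum]
    have e1 : K ^ C = 2 * (h * ∑ i ∈ Finset.range C, K ^ i) + 1 := by
      have : K - 1 = 2 * h := by rw [hK]; ring
      nlinarith
    omega
  have hsum : ∑ x ∈ S, e x * K ^ c x =
      ∑ i ∈ Finset.range C, (∑ x ∈ S with c x = i, e x) * K ^ i := by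
    rw [← Finset.sum_fiberwise_of_maps_to (t := Finset.range C) (g := c)
      fun x hx => Finset.mem_range.2 (hc x hx)]
    refine Finset.sum_congr rfl fun i _ => ?_
    rw [Finset.sum_mul]
    exact Finset.sum_congr rfl fun x hx => by rw [(Finset.mem_filter.1 hx).2]
  rw [hsum, hhalf, ← Finset.sum_add_distrib]
  simp_rw [← add_mul]
  have hz : ∀ i, |∑ x ∈ S with c x = i, e x| ≤ h := fun i => by
    refine (Finset.abs_sum_le_sum_abs _ _).trans ?_
    refine (Finset.sum_le_card_nsmul _ _ 1 fun x hx => he x (Finset.mem_filter.1 hx).1).trans ?_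
    have := Finset.card_filter_le S fun x => c x = i
    simp only [nsmul_eq_mul, mul_one]
    omega
  rw [digit_sum (fun i => (∑ x ∈ S with c x = i, e x) + h) _ hm, add_comm]
  intro i _
  have := abs_le.1 (hz i)
  constructor <;> omega

/-! ### The isolation lemma -/

section Isolation

variable {n : ℕ}

/-- The weight of a permutation, considered as a perfect matching. -/
def permWeight (u : Fin n → Fin n → ℕ) (σ : Equiv.Perm (Fin n)) : ℕ := ∑ i, u i (σ i)

/-- `σ` has least weight in the family `F`. -/
def IsLightest (F : Finset (Equiv.Perm (Fin n))) (u : Fin n → Fin n → ℕ)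
    (σ : Equiv.Perm (Fin n)) : Prop :=
  σ ∈ F ∧ ∀ τ ∈ F, permWeight u σ ≤ permWeight u τ

/-- The edge `(i, j)` lies in some but not in all members of `F` of least weight. -/
def Ambiguous (F : Finset (Equiv.Perm (Fin n))) (u : Fin n → Fin n → ℕ) (i j : Fin n) : Prop :=
  ∃ σ τ, IsLightest F u σ ∧ IsLightest F u τ ∧ σ i = j ∧ τ i ≠ j

/-- The member of least weight is unique. -/
def Isolating (F : Finset (Equiv.Perm (Fin n))) (u : Fin n → Fin n → ℕ) : Prop :=
  ∃ σ ∈ F, ∀ τ ∈ F, τ ≠ σ → permWeight u σ < permWeight u τ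

theorem exists_ambiguous {F : Finset (Equiv.Perm (Fin n))} (hF : F.Nonempty)
    {u : Fin n → Fin n → ℕ} (h : ¬ Isolating F u) : ∃ i j, Ambiguous F u i j := by
  obtain ⟨σ, hσ, hmin⟩ := F.exists_min_image (permWeight u) hF
  simp only [Isolating, not_exists, not_and, not_forall, not_lt] at h
  obtain ⟨τ, hτ, hne, hle⟩ := h σ hσ
  obtain ⟨i, hi⟩ : ∃ i, τ i ≠ σ i := by
    by_contra! hc
    exact hne (Equiv.ext hc)
  exact ⟨i, σ i, σ, τ, ⟨hσ, hmin⟩, ⟨hτ, fun ρ hρ => hle.trans (hmin ρ hρ)⟩, rfl, hi⟩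

theorem permWeight_of_ne {u u' : Fin n → Fin n → ℕ} {i j : Fin n}
    (h : ∀ i' j', (i', j') ≠ (i, j) → u i' j' = u' i' j') {σ : Equiv.Perm (Fin n)} (hσ : σ i ≠ j) :
    permWeight u σ = permWeight u' σ :=
  Finset.sum_congr rfl fun l _ => h _ _ fun he => hσ (by
    obtain ⟨rfl, h2⟩ := Prod.mk.inj he
    exact h2)

theorem permWeight_of_eq {u u' : Fin n → Fin n → ℕ} {i j : Fin n}
    (h : ∀ i' j', (i', j') ≠ (i, j) → u i' j' = u' i' j') {σ : Equiv.Perm (Fin n)} (hσ : σ i = j) :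
    permWeight u σ + u' i j = permWeight u' σ + u i j := by
  unfold permWeight
  rw [← Finset.sum_erase_add _ _ (Finset.mem_univ i),
    ← Finset.sum_erase_add _ (fun i => u' i (σ i)) (Finset.mem_univ i), hσ,
    Finset.sum_congr rfl fun l hl => h l (σ l) fun he =>
      Finset.ne_of_mem_erase hl (Prod.mk.inj he).1]
  ring

/-- The weights of the other edges determine the weight at which an edge is ambiguous. -/
theorem Ambiguous.eq {F : Finset (Equiv.Perm (Fin n))} {u u' : Fin n → Fin n → ℕ} {i j : Fin n}
    (h : ∀ i' j', (i', j') ≠ (i, j) → u i' j' = u' i' j')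
    (hu : Ambiguous F u i j) (hu' : Ambiguous F u' i j) : u i j = u' i j := by
  obtain ⟨σ, τ, hσ, hτ, hs, ht⟩ := hu
  obtain ⟨σ', τ', hσ', hτ', hs', ht'⟩ := hu'
  have h1 := hσ'.2 τ hτ.1
  have h2 := hτ.2 σ' hσ'.1
  have h3 := hσ.2 τ' hτ'.1
  have h4 := hτ'.2 σ hσ.1
  have e1 := permWeight_of_ne h ht
  have e2 := permWeight_of_eq h hs'
  have e3 := permWeight_of_ne h ht'
  have e4 := permWeight_of_eq h hs
  omega

/-- The number whose binary digits are the `b` coins tossed from time `c` on. -/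
def randNum (ω : ℕ → Bool) (c : ℕ) : ℕ → ℕ
  | 0 => 0
  | r + 1 => 2 * randNum ω c r + (ω (c + r)).toNat

theorem randNum_lt (ω : ℕ → Bool) (c b : ℕ) : randNum ω c b < 2 ^ b := by
  induction b with
  | zero => simp [randNum]
  | succ b ih =>
    have := Bool.toNat_le (ω (c + b))
    rw [randNum, pow_succ]
    omega

theorem randNum_inj {ω ω' : ℕ → Bool} {c b : ℕ} :
    randNum ω c b = randNum ω' c b ↔ ∀ r < b, ω (c + r) = ω' (c + r) := by
  induction b with
  | zero => simp [randNum]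
  | succ b ih =>
    have h1 := Bool.toNat_le (ω (c + b))
    have h2 := Bool.toNat_le (ω' (c + b))
    rw [Nat.forall_lt_succ_right, ← ih, randNum, randNum]
    have h3 : (ω (c + b)).toNat = (ω' (c + b)).toNat ↔ ω (c + b) = ω' (c + b) := by
      cases ω (c + b) <;> cases ω' (c + b) <;> simp
    rw [← h3]
    omega

/-- The number of the edge `(i, j)`. -/
def edgeIdx (i j : Fin n) : ℕ := i * n + j

/-- The random weight of the edge `(i, j)`, made from `b` coins of its own. -/
def randWeight (ω : ℕ → Bool) (b : ℕ) (i j : Fin n) : ℕ := randNum ω (edgeIdx i j * b) b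

theorem edgeIdx_lt (i j : Fin n) : edgeIdx i j < n * n := by
  unfold edgeIdx
  have h1 : (i : ℕ) + 1 ≤ n := i.isLt
  have h2 := Nat.mul_le_mul_right n h1
  have := j.isLt
  rw [add_mul] at h2
  omega

theorem edgeIdx_inj {i j i' j' : Fin n} (h : edgeIdx i j = edgeIdx i' j') : i = i' ∧ j = j' := by
  unfold edgeIdx at h
  have hn : 0 < n := i.pos
  have h1 := congrArg (· / n) h
  have h2 := congrArg (· % n) h
  simp only [mul_comm _ n, Nat.mul_add_div hn, Nat.mul_add_mod, Nat.div_eq_of_lt j.isLt,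
    Nat.div_eq_of_lt j'.isLt, Nat.mod_eq_of_lt j.isLt, Nat.mod_eq_of_lt j'.isLt, add_zero] at h1 h2
  exact ⟨Fin.ext h1, Fin.ext h2⟩

theorem edgeIdx_cast (i j : Fin n) : (edgeIdx i j : ℤ) = (i : ℕ) * n + (j : ℕ) := by
  simp [edgeIdx]

theorem edgeIdx_div (i j : Fin n) : (edgeIdx i j : ℤ) / n = (i : ℕ) := by
  have hn : (0 : ℤ) < n := by exact_mod_cast i.pos
  rw [edgeIdx_cast, add_comm, Int.add_mul_ediv_right _ _ hn.ne',
    Int.ediv_eq_zero_of_lt (by omega) (by exact_mod_cast j.isLt), zero_add]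

theorem edgeIdx_mod (i j : Fin n) : (edgeIdx i j : ℤ) % n = (j : ℕ) := by
  rw [edgeIdx_cast, add_comm, Int.add_mul_emod_self_right,
    Int.emod_eq_of_lt (by omega) (by exact_mod_cast j.isLt)]

theorem exists_edgeIdx {k : ℕ} (hk : k < n * n) : ∃ i j : Fin n, k = edgeIdx i j := by
  have hn : 0 < n := Nat.pos_of_ne_zero (by rintro rfl; simp at hk)
  exact ⟨⟨k / n, Nat.div_lt_of_lt_mul hk⟩, ⟨k % n, Nat.mod_lt _ hn⟩, (Nat.div_add_mod' k n).symm⟩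

theorem forall_edgeIdx_succ {p : Fin n → Fin n → Prop} {i j : Fin n}
    (h : ∀ i' j', edgeIdx i' j' < edgeIdx i j → p i' j') (hij : p i j) (i' j' : Fin n)
    (hlt : edgeIdx i' j' < edgeIdx i j + 1) : p i' j' := by
  rcases Nat.lt_succ_iff_lt_or_eq.1 hlt with h' | h'
  · exact h i' j' h'
  · obtain ⟨rfl, rfl⟩ := edgeIdx_inj h'
    exact hij

/-- A finite sequence of coin tosses, continued by `false`. -/
def extend {k : ℕ} (c : Fin k → Bool) (t : ℕ) : Bool := if h : t < k then c ⟨t, h⟩ else false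

theorem randWeight_extend (ω : ℕ → Bool) (b : ℕ) :
    (randWeight ω b : Fin n → Fin n → ℕ) =
      randWeight (extend fun t : Fin (n * n * b) => ω t) b := by
  funext i j
  refine randNum_inj.2 fun r hr => ?_
  have h : edgeIdx i j * b + r < n * n * b := by
    have := Nat.mul_le_mul_right b (Nat.succ_le_of_lt (edgeIdx_lt i j))
    rw [Nat.succ_mul] at this
    omega
  simp [extend, h]

open Classical in
/-- A given edge is ambiguous for at most a fraction of `2 ^ (-b)` of the outcomes. -/
theorem card_ambiguous_mul_le (F : Finset (Equiv.Perm (Fin n))) (b : ℕ) (i j : Fin n) :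
    (Finset.univ.filter fun c : Fin (n * n * b) → Bool =>
      Ambiguous F (randWeight (extend c) b) i j).card * 2 ^ b ≤ 2 ^ (n * n * b) := by
  set e := edgeIdx i j * b with he
  have heb : e + b ≤ n * n * b := by
    have := Nat.mul_le_mul_right b (Nat.succ_le_of_lt (edgeIdx_lt i j))
    rw [Nat.succ_mul] at this
    omega
  -- overwriting the coins of the edge `(i, j)` is injective on the ambiguous outcomes
  let φ : (Fin (n * n * b) → Bool) × (Fin b → Bool) → (Fin (n * n * b) → Bool) := fun p t =>
    if h : e ≤ t ∧ (t : ℕ) - e < b then p.2 ⟨t - e, h.2⟩ else p.1 t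
  have hφ := Finset.card_le_card_of_injOn (s := (Finset.univ.filter fun c =>
    Ambiguous F (randWeight (extend c) b) i j) ×ˢ Finset.univ) (t := Finset.univ) φ
    (fun _ _ => Finset.mem_univ _) ?_
  · simpa using hφ
  rintro ⟨c, x⟩ hc ⟨c', x'⟩ hc' h
  simp only [Finset.coe_product, Finset.coe_filter, Finset.mem_univ, true_and, Finset.coe_univ,
    Set.mem_prod, Set.mem_ofPred_eq, Set.mem_univ, and_true] at hc hc'
  have hoff : ∀ t (ht : t < n * n * b), ¬ (e ≤ t ∧ t - e < b) → c ⟨t, ht⟩ = c' ⟨t, ht⟩ := by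
    intro t ht hn
    have := congrFun h ⟨t, ht⟩
    simpa only [φ, dif_neg hn] using this
  have hu : ∀ i' j', (i', j') ≠ (i, j) →
      randWeight (extend c) b i' j' = randWeight (extend c') b i' j' := by
    intro i' j' hne
    refine randNum_inj.2 fun r hr => ?_
    simp only [extend]
    split_ifs with ht
    · refine hoff _ ht fun hh => hne ?_
      have hdiv : edgeIdx i' j' = edgeIdx i j := by
        have e1 : edgeIdx i' j' * b < (edgeIdx i j + 1) * b := by
          rw [add_mul _ 1]; omega
        have e2 : edgeIdx i j * b < (edgeIdx i' j' + 1) * b := by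
          rw [add_mul _ 1]; omega
        have e3 := Nat.lt_of_mul_lt_mul_right e1
        have e4 := Nat.lt_of_mul_lt_mul_right e2
        omega
      obtain ⟨rfl, rfl⟩ := edgeIdx_inj hdiv
      rfl
    · rfl
  have hin := randNum_inj.1 (Ambiguous.eq hu hc hc')
  refine Prod.ext (funext fun t => ?_) (funext fun r => ?_)
  · by_cases ht : e ≤ t ∧ (t : ℕ) - e < b
    · have := hin (t - e) ht.2
      rw [← he, Nat.add_sub_cancel' ht.1] at this
      simpa [extend, t.isLt] using this
    · exact hoff t t.isLt ht
  · have := congrFun h ⟨e + r, by omega⟩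
    simpa [φ] using this

open Classical in
/-- By the union bound over the `n ^ 2` edges, at most half of the outcomes are not isolating. -/
theorem card_not_isolating_mul_le {F : Finset (Equiv.Perm (Fin n))} (hF : F.Nonempty) {b : ℕ}
    (hn : 0 < n) (hb : 2 * (n * n) ≤ 2 ^ b) :
    2 * (Finset.univ.filter fun c : Fin (n * n * b) → Bool =>
      ¬ Isolating F (randWeight (extend c) b)).card ≤ 2 ^ (n * n * b) := by
  set B := Finset.univ.filter fun c : Fin (n * n * b) → Bool =>
      ¬ Isolating F (randWeight (extend c) b) with hB
  have h1 : B.card ≤ ∑ p : Fin n × Fin n, (Finset.univ.filter fun c : Fin (n * n * b) → Bool =>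
      Ambiguous F (randWeight (extend c) b) p.1 p.2).card := by
    refine (Finset.card_le_card fun c hc => ?_).trans Finset.card_biUnion_le
    obtain ⟨i, j, h⟩ := exists_ambiguous hF (Finset.mem_filter.1 hc).2
    exact Finset.mem_biUnion.2 ⟨(i, j), Finset.mem_univ _, by simpa using h⟩
  have h2 : B.card * 2 ^ b ≤ n * n * 2 ^ (n * n * b) := by
    refine (Nat.mul_le_mul_right _ h1).trans ?_
    rw [Finset.sum_mul]
    refine (Finset.sum_le_card_nsmul _ _ _ fun p _ => card_ambiguous_mul_le F b p.1 p.2).trans ?_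
    simp
  have h3 : B.card * (2 * (n * n)) ≤ n * n * 2 ^ (n * n * b) :=
    (Nat.mul_le_mul_left _ hb).trans h2
  refine le_of_mul_le_mul_left (a := n * n) ?_ (by positivity)
  linarith

open MeasureTheory in
theorem coinMeasure_cylinder {k : ℕ} (c : Fin k → Bool) :
    coinMeasure {ω | (fun t : Fin k => ω t) = c} = 2⁻¹ ^ k := by
  have h : {ω : ℕ → Bool | (fun t : Fin k => ω t) = c} =
      Set.pi (Finset.range k : Set ℕ) fun t => {extend c t} := by
    ext ω
    simp only [Set.mem_ofPred_eq, Set.mem_pi, Finset.coe_range, Set.mem_Iio, Set.mem_singleton_iff,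
      funext_iff]
    refine ⟨fun h t ht => by simp [extend, ht, ← h], fun h t => by simpa [extend] using h t t.isLt⟩
  rw [h, coinMeasure, Measure.infinitePi_pi]
  · simp
  · intro i _
    exact measurableSet_singleton _

open Classical MeasureTheory in
/-- An event that depends on the first `k` coins only and holds for at least half of their
outcomes has probability at least `1 / 2`. -/
theorem half_le_coinMeasure {k : ℕ} {p : (Fin k → Bool) → Prop}
    (h : 2 * (Finset.univ.filter fun c => ¬ p c).card ≤ 2 ^ k) :
    1 / 2 ≤ coinMeasure {ω | p fun t => ω t} := by
  have h1 : {ω : ℕ → Bool | p fun t => ω t} =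
      ⋃ c ∈ Finset.univ.filter p, {ω | (fun t : Fin k => ω t) = c} := by
    ext ω; simp
  have hm : ∀ c : Fin k → Bool, MeasurableSet {ω : ℕ → Bool | (fun t : Fin k => ω t) = c} := by
    intro c
    have : Measurable fun (ω : ℕ → Bool) (t : Fin k) => ω t := by fun_prop
    exact this (measurableSet_singleton c)
  rw [h1, measure_biUnion_finset _ fun c _ => hm c]
  · simp only [coinMeasure_cylinder, Finset.sum_const, nsmul_eq_mul]
    have h2 := Finset.card_filter_add_card_filter_not (s := (Finset.univ : Finset (Fin k → Bool))) p
    have h3 : 2 ^ k ≤ 2 * (Finset.univ.filter p).card := by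
      simp at h2
      omega
    rw [ENNReal.div_le_iff (by norm_num) (by norm_num)]
    have h4 : (2 : ENNReal) ^ k ≤ 2 * (Finset.univ.filter p).card := by exact_mod_cast h3
    calc (1 : ENNReal) = 2 ^ k * 2⁻¹ ^ k := by
          rw [← mul_pow, ENNReal.mul_inv_cancel (by norm_num) (by norm_num), one_pow]
      _ ≤ (2 * (Finset.univ.filter p).card) * 2⁻¹ ^ k := by gcongr
      _ = _ := by ring
  · intro c _ c' _ hne
    refine Set.disjoint_left.2 fun ω h h' => hne ?_
    exact h.symm.trans h'

/-- The isolation lemma of Mulmuley, Vazirani and Vazirani. -/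
theorem half_le_isolating {F : Finset (Equiv.Perm (Fin n))} (hF : F.Nonempty) {b : ℕ}
    (hn : 0 < n) (hb : 2 * (n * n) ≤ 2 ^ b) :
    1 / 2 ≤ coinMeasure {ω | Isolating F (randWeight ω b)} := by
  have h : {ω | Isolating F (randWeight ω b)} =
      {ω | Isolating F (randWeight (extend fun t : Fin (n * n * b) => ω t) b)} := by
    ext ω
    rw [Set.mem_ofPred_eq, Set.mem_ofPred_eq, randWeight_extend]
  rw [h]
  exact half_le_coinMeasure (p := fun c => Isolating F (randWeight (extend c) b))
    (by convert card_not_isolating_mul_le hF hn hb)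

end Isolation

/-! ### The program -/

instance : Add Expr := ⟨.op .add⟩
instance : Sub Expr := ⟨.op .sub⟩
instance : Mul Expr := ⟨.op .mul⟩
instance : Div Expr := ⟨.op .div⟩
instance : Mod Expr := ⟨.op .mod⟩
instance (k : ℕ) : OfNat Expr k := ⟨.const k⟩

namespace Expr

/-- The truth value of `e₁ ≤ e₂`. -/
def leq (e₁ e₂ : Expr) : Expr := .op .le e₁ e₂

/-- The truth value of `e₁ = e₂`. -/
def equ (e₁ e₂ : Expr) : Expr := .op .eq e₁ e₂

variable (s : State) (e₁ e₂ : Expr)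

@[simp] theorem val_add : (e₁ + e₂).val s = e₁.val s + e₂.val s := rfl
@[simp] theorem val_sub : (e₁ - e₂).val s = e₁.val s - e₂.val s := rfl
@[simp] theorem val_mul : (e₁ * e₂).val s = e₁.val s * e₂.val s := rfl
@[simp] theorem val_div : (e₁ / e₂).val s = e₁.val s / e₂.val s := rfl
@[simp] theorem val_mod : (e₁ % e₂).val s = e₁.val s % e₂.val s := rfl
@[simp] theorem val_zero : (0 : Expr).val s = 0 := rfl
@[simp] theorem val_one : (1 : Expr).val s = 1 := rfl
@[simp] theorem val_two : (2 : Expr).val s = 2 := rfl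
@[simp] theorem val_leq :
    (leq e₁ e₂).val s = if e₁.val s ≤ e₂.val s then 1 else 0 := rfl
@[simp] theorem val_equ : (equ e₁ e₂).val s = if e₁.val s = e₂.val s then 1 else 0 := rfl
@[simp] theorem val_var (x : ℕ) : (var x).val s = s.var x := rfl
@[simp] theorem val_const (c : ℤ) : (const c).val s = c := rfl
@[simp] theorem val_get (a : ℕ) (i : Expr) : (get a i).val s = s.arr a (i.val s) := rfl

end Expr

/- Names for the variables (prefix `v`) and the arrays (prefix `a`) of the program. The values of
`vN` and `aIn` are the input and `aOut` is read as the output, so these three numbers are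
prescribed. -/
notation "vN" => (0 : ℕ)
notation "vW" => (1 : ℕ)
notation "vNN" => (2 : ℕ)
notation "vDNN" => (3 : ℕ)
notation "vTwoN" => (4 : ℕ)
notation "vD" => (5 : ℕ)
notation "vCube" => (6 : ℕ)
notation "vBits" => (7 : ℕ)
notation "vBase" => (8 : ℕ)
notation "vBaseD" => (9 : ℕ)
notation "vH" => (10 : ℕ)
notation "vK" => (11 : ℕ)
notation "vQ" => (12 : ℕ)
notation "vC" => (13 : ℕ)
notation "vTop" => (14 : ℕ)
notation "vHalf" => (15 : ℕ)
notation "vI" => (16 : ℕ)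
notation "vJ" => (17 : ℕ)
notation "vM" => (18 : ℕ)
notation "vAcc" => (19 : ℕ)
notation "vPow" => (20 : ℕ)
notation "vU" => (21 : ℕ)
notation "vX" => (22 : ℕ)
notation "vP" => (23 : ℕ)
notation "vTr" => (24 : ℕ)
notation "vFlag" => (25 : ℕ)
notation "vBest" => (26 : ℕ)
notation "vS" => (27 : ℕ)
notation "vT" => (28 : ℕ)
notation "aIn" => (0 : ℕ)
notation "aOut" => (1 : ℕ)
notation "aPow" => (2 : ℕ)
notation "aA" => (3 : ℕ)
notation "aB" => (4 : ℕ)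
notation "aT" => (5 : ℕ)
notation "aCand" => (6 : ℕ)
notation "aBest" => (7 : ℕ)
infixr:60 " ;; " => Prog.seq

open NonlinearMatching.Expr

/-- The numbers of edges and of weights. -/
def countProg (d : ℕ) : Prog :=
  .assign vNN (var vN * var vN) ;;
  .assign vD (const d) ;;
  .assign vDNN (var vD * var vNN) ;;
  .assign vTwoN (var vN + var vN)

/-- The sum of the squares of all weights. -/
def sumSqProg : Prog :=
  .assign vW 0 ;;
  .for vI vDNN (.assign vW (var vW + get aIn (var vI) * get aIn (var vI)))

/-- The least power of two that is at least `2 n²`, and its exponent. -/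
def bitsProg : Prog :=
  .assign vCube 1 ;;
  .assign vBits 0 ;;
  .for vI vTwoN (
    .assign vX (leq (var vCube + 1) (2 * var vNN)) ;;
    .assign vCube (var vCube + var vCube * var vX) ;;
    .assign vBits (var vBits + var vX))

/-- The base in which weight vectors are encoded, and its `d`-th power. -/
def baseProg : Prog :=
  .assign vBase (2 * var vN * var vW + 1) ;;
  .assign vBaseD 1 ;;
  .for vI vD (.assign vBaseD (var vBaseD * var vBase))

/-- The base `K = 2 nⁿ + 1` of the large numbers, and the range of the exponents. -/
def bigBaseProg : Prog :=
  .assign vH 1 ;;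
  .for vI vN (.assign vH (var vH * var vN)) ;;
  .assign vK (2 * var vH + 1) ;;
  .assign vQ (var vN * var vCube) ;;
  .assign vC (var vQ * var vBaseD)

/-- The table of the powers of `K`. -/
def powersProg : Prog :=
  .assign vTop 1 ;;
  .for vI vC (
    .store aPow (var vI) (var vTop) ;;
    .assign vTop (var vTop * var vK)) ;;
  .assign vHalf (var vTop / 2)

/-- Compute the parameters. -/
def setupProg (d : ℕ) : Prog :=
  countProg d ;; sumSqProg ;; bitsProg ;; baseProg ;; bigBaseProg ;; powersProg

/-- Fill the matrix with the powers of `K` given by the encoded and perturbed weights. -/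
def matrixProg : Prog :=
  .for vI vNN (
    .assign vAcc 0 ;;
    .assign vPow 1 ;;
    .for vJ vD (
      .assign vAcc (var vAcc + (get aIn (var vJ * var vNN + var vI) + var vW) * var vPow) ;;
      .assign vPow (var vPow * var vBase)) ;;
    .assign vU 0 ;;
    .for vJ vBits (
      .toss vX ;;
      .assign vU (2 * var vU + var vX)) ;;
    .store aA (var vI) (get aPow (var vAcc * var vQ + var vU)))

/-- One step of the Faddeev–LeVerrier recursion. -/
def stepProg : Prog :=
  .for vI vNN (
    .store aB (var vI) (get aT (var vI) + var vP * equ (var vI / var vN) (var vI % var vN))) ;;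
  .for vI vNN (
    .assign vAcc 0 ;;
    .for vJ vN (
      .assign vAcc (var vAcc +
        get aA (var vI / var vN * var vN + var vJ) *
          get aB (var vJ * var vN + var vI % var vN))) ;;
    .store aT (var vI) (var vAcc)) ;;
  .assign vTr 0 ;;
  .for vI vN (.assign vTr (var vTr + get aT (var vI * var vN + var vI))) ;;
  .assign vP ((0 - var vTr) / (var vM + 1))

/-- The Faddeev–LeVerrier recursion: the determinant and the adjugate, up to sign. -/
def adjugateProg : Prog :=
  .assign vP 1 ;; .for vM vN stepProg

/-- The digit of `z` at position `c`, increased by the number `(K - 1) / 2` in `vH`. -/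
def digitExpr (z c : Expr) : Expr := (z + var vHalf) / get aPow c % var vK

/-- Decode the weight vectors of the candidate and of the best vector so far, which are encoded in
`vS` and `vT`. -/
def decodeProg : Prog :=
  .for vJ vD (
    .store aCand (var vJ) (var vS % var vBase - var vN * var vW) ;;
    .assign vS (var vS / var vBase) ;;
    .store aBest (var vJ) (var vT % var vBase - var vN * var vW) ;;
    .assign vT (var vT / var vBase))

/-- The query whether the candidate is not better than the best vector found so far. -/
def compareProg : Goal → Prog
  | .maximize => .query vX aCand aBest
  | .minimize => .query vX aBest aCand

/-- Search the best vector among those that occur with nonzero coefficient in the determinant. -/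
def searchProg (goal : Goal) : Prog :=
  .assign vFlag 0 ;;
  .assign vBest 0 ;;
  .for vI vC (
    .cond (equ (digitExpr (var vP) (var vI)) (var vH)) .skip (
      .assign vS (var vI / var vQ) ;;
      .assign vT (var vBest / var vQ) ;;
      decodeProg ;;
      .assign vX 0 ;;
      .cond (var vFlag) (compareProg goal) .skip ;;
      .cond (var vX) .skip (.assign vFlag 1 ;; .assign vBest (var vI))))

/-- Exchange entries of the output so that the entry at `i = vI / n` becomes `j = vI % n`. -/
def swapProg : Prog :=
  .for vJ vN (
    .cond (equ (get aOut (var vJ)) (var vI % var vN))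
      (.store aOut (var vJ) (get aOut (var vI / var vN)) ;;
        .store aOut (var vI / var vN) (var vI % var vN))
      .skip)

/-- Read the matching off the adjugate. -/
def outputProg : Prog :=
  .for vI vN (.store aOut (var vI) (var vI)) ;;
  .for vI vNN (
    .cond (equ (digitExpr (get aA (var vI) *
        get aB (var vI % var vN * var vN + var vI / var vN)) (var vBest)) (var vH))
      .skip swapProg)

/-- The whole algorithm. -/
def matchingProg (d : ℕ) (goal : Goal) : Prog :=
  setupProg d ;; matrixProg ;; adjugateProg ;; searchProg goal ;; outputProg

/-! ### The parameters -/

section Parameters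

variable {d n : ℕ} (w : Fin d → Fin n → Fin n → ℤ)

/-- The sum of the squares of all weights; it bounds the absolute value of every weight. -/
def sumSq : ℕ := ∑ p ∈ Finset.range (d * (n * n)), ((input w).arr 0 p).natAbs ^ 2

/-- The number of coins tossed for one edge, the least `b` with `2 n ^ 2 ≤ 2 ^ b`: twice the number
of edges, as the isolation lemma demands. -/
def numBits (n : ℕ) : ℕ := Nat.clog 2 (2 * (n * n))

/-- The base in which weight vectors are encoded. -/
def base : ℕ := 2 * n * sumSq w + 1

/-- A strict upper bound for the perturbation of a perfect matching. -/
def scale (n : ℕ) : ℕ := n * 2 ^ numBits n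

/-- A strict upper bound for the encoded and perturbed weight of a perfect matching. -/
def codeBound : ℕ := scale n * base w ^ d

/-- The base `K = 2 nⁿ + 1` of the large numbers. -/
def bigBase (n : ℕ) : ℕ := 2 * n ^ n + 1

/-- A bound for the number of iterations of every loop. -/
def iterBound : ℕ := d * (n * n) + 2 * n + codeBound w

/-- A bound for all numbers that the program stores; the power is the bound for the recursion of
Faddeev and LeVerrier that `abs_adjCoeff_le` gives for entries up to `K ^ codeBound`, with one more
factor for the intermediate sums. -/
def valueBound : ℕ :=
  iterBound w + (2 * n ^ 3 * (bigBase n ^ codeBound w) ^ 2) ^ (n + 1)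

variable {w}

theorem numBits_le (n : ℕ) : numBits n ≤ 2 * n := by
  refine Nat.clog_le_of_le_pow ?_
  rcases n with _ | n
  · simp
  have h : n + 1 ≤ 2 ^ n := Nat.lt_two_pow_self
  have := Nat.mul_le_mul h h
  calc 2 * ((n + 1) * (n + 1)) ≤ 2 * (2 ^ n * 2 ^ n) := Nat.mul_le_mul_left _ this
    _ ≤ 2 ^ (2 * (n + 1)) := by
      rw [show 2 * (n + 1) = n + n + 1 + 1 by ring]
      simp only [pow_succ, pow_add]; omega

theorem le_two_pow_numBits (n : ℕ) : 2 * (n * n) ≤ 2 ^ numBits n :=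
  Nat.le_pow_clog (by norm_num) _

theorem two_pow_numBits_le {n : ℕ} (hn : 0 < n) : 2 ^ numBits n ≤ 4 * (n * n) := by
  have h1 : 1 < 2 * (n * n) := by nlinarith
  have h := Nat.pow_pred_clog_lt_self (b := 2) (by norm_num) h1
  have h2 : 0 < numBits n := Nat.clog_pos (by norm_num) h1
  have h3 : 2 ^ numBits n = 2 * 2 ^ (numBits n).pred := by
    rw [← pow_succ', Nat.pred_eq_sub_one, Nat.sub_add_cancel h2]
  have h4 : 2 ^ (numBits n).pred < 2 * (n * n) := h
  omega

theorem base_pos : 0 < base w := by unfold base; omega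

theorem sumSq_lt_base (hn : 0 < n) : sumSq w < base w := by
  unfold base; nlinarith [Nat.zero_le (sumSq w)]

theorem scale_pos (hn : 0 < n) : 0 < scale n := by unfold scale; positivity

theorem codeBound_pos (hn : 0 < n) : 0 < codeBound w :=
  Nat.mul_pos (scale_pos hn) (pow_pos base_pos d)

theorem base_pow_le {k : ℕ} (hn : 0 < n) (hk : k ≤ d) : base w ^ k ≤ codeBound w :=
  (Nat.pow_le_pow_right base_pos hk).trans (Nat.le_mul_of_pos_left _ (scale_pos hn))

theorem base_le (hd : 0 < d) (hn : 0 < n) : base w ≤ codeBound w := by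
  simpa using base_pow_le (w := w) (k := 1) hn hd

theorem scale_le : scale n ≤ codeBound w :=
  Nat.le_mul_of_pos_right _ (pow_pos base_pos d)

theorem two_pow_le (hn : 0 < n) : 2 ^ numBits n ≤ codeBound w :=
  (Nat.le_mul_of_pos_left _ hn).trans scale_le

theorem bigBase_pow_le (hn : 0 < n) {c : ℕ} (hc : c ≤ codeBound w) :
    bigBase n ^ c ≤ valueBound w := by
  have h0 : 0 < bigBase n := by unfold bigBase; omega
  set y := bigBase n ^ codeBound w with hy
  have hy0 : 0 < y := pow_pos h0 _
  have h1 : y ≤ 2 * n ^ 3 * y ^ 2 := by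
    have : 0 < 2 * n ^ 3 * y := by positivity
    calc y ≤ (2 * n ^ 3 * y) * y := Nat.le_mul_of_pos_left _ this
      _ = _ := by ring
  have h2 : 2 * n ^ 3 * y ^ 2 ≤ (2 * n ^ 3 * y ^ 2) ^ (n + 1) := Nat.le_self_pow n.succ_ne_zero _
  have h3 : bigBase n ^ c ≤ y := Nat.pow_le_pow_right h0 hc
  exact (h3.trans h1).trans (h2.trans (Nat.le_add_left _ _))

theorem iterBound_le : iterBound w ≤ valueBound w := Nat.le_add_right _ _

theorem codeBound_le_iterBound : codeBound w ≤ iterBound w := Nat.le_add_left _ _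

theorem le_iterBound (hd : 0 < d) (hn : 0 < n) : d ≤ iterBound w ∧ n ≤ iterBound w ∧
    n * n ≤ iterBound w ∧ 2 * n ≤ iterBound w ∧ d * (n * n) ≤ iterBound w ∧
    numBits n ≤ iterBound w ∧ 1 ≤ iterBound w := by
  have h1 : n * n ≤ d * (n * n) := Nat.le_mul_of_pos_left _ hd
  have h2 : d ≤ d * (n * n) := Nat.le_mul_of_pos_right _ (by positivity)
  have h3 := numBits_le n
  unfold iterBound
  omega

end Parameters

section Setup

variable {d n : ℕ} (w : Fin d → Fin n → Fin n → ℤ)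

/-- The parameters have been computed. -/
structure Setup (s : State) : Prop where
  n_eq : s.var vN = n
  w_eq : s.var vW = sumSq w
  nn_eq : s.var vNN = (n * n : ℕ)
  d_eq : s.var vD = d
  bits_eq : s.var vBits = numBits n
  base_eq : s.var vBase = base w
  h_eq : s.var vH = (n ^ n : ℕ)
  k_eq : s.var vK = bigBase n
  q_eq : s.var vQ = scale n
  c_eq : s.var vC = codeBound w
  half_eq : s.var vHalf = (bigBase n : ℤ) ^ codeBound w / 2
  in_eq : s.arr aIn = (input w).arr aIn
  pow_eq : ∀ c : ℕ, c < codeBound w → s.arr aPow c = (bigBase n : ℤ) ^ c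

/-- The program does not change the parameters. -/
def Prog.keepsSetup (P : Prog) : Bool :=
  [vN, vW, vNN, vD, vBits, vBase, vH, vK, vQ, vC, vHalf].all (fun x => P.keepsVar x) &&
    [aIn, aPow].all fun a => P.keepsArr a

variable {w}

theorem Setup.frame {P : Prog} {s s' : State} (h : Setup w s) (hf : Frame P s s')
    (hP : P.keepsSetup = true) : Setup w s' := by
  simp only [Prog.keepsSetup, List.all_cons, List.all_nil, Bool.and_true, Bool.and_eq_true] at hP
  obtain ⟨⟨h1, h2, h3, h4, h5, h6, h7, h8, h9, h10, h11⟩, k1, k2⟩ := hP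
  exact ⟨by rw [hf.var h1, h.n_eq], by rw [hf.var h2, h.w_eq], by rw [hf.var h3, h.nn_eq],
    by rw [hf.var h4, h.d_eq], by rw [hf.var h5, h.bits_eq], by rw [hf.var h6, h.base_eq],
    by rw [hf.var h7, h.h_eq], by rw [hf.var h8, h.k_eq], by rw [hf.var h9, h.q_eq],
    by rw [hf.var h10, h.c_eq], by rw [hf.var h11, h.half_eq], by rw [hf.arr k1, h.in_eq],
    by rw [hf.arr k2]; exact h.pow_eq⟩

variable {O : (Fin d → ℤ) → (Fin d → ℤ) → Prop} {ω : ℕ → Bool}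

theorem run_count (hd : 0 < d) (hn : 0 < n) {s : State} (hsn : s.var vN = n) :
    Run O ω (iterBound w) (valueBound w) (countProg d) s fun s =>
      s.var vNN = (n * n : ℕ) ∧ s.var vD = d ∧ s.var vDNN = (d * (n * n) : ℕ) ∧
        s.var vTwoN = (2 * n : ℕ) := by
  obtain ⟨b1, b2, b3, b4, b5, b6, b7⟩ := le_iterBound (w := w) hd hn
  have hN := iterBound_le (w := w)
  refine Run.seq (Run.assign_nat (n * n) (by simp [hsn]) (by omega) ?_)
  refine Run.seq (Run.assign_nat d (by simp) (by omega) ?_)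
  refine Run.seq (Run.assign_nat (d * (n * n)) (by simp) (by omega) ?_)
  refine Run.assign_nat (2 * n) (by simp [hsn, two_mul]) (by omega) ?_
  simp

theorem run_sumSq (hd : 0 < d) (hn : 0 < n) {s : State} (hs : s.var vDNN = (d * (n * n) : ℕ))
    (hin : s.arr aIn = (input w).arr aIn) :
    Run O ω (iterBound w) (valueBound w) sumSqProg s fun s => s.var vW = sumSq w := by
  obtain ⟨b1, b2, b3, b4, b5, b6, b7⟩ := le_iterBound (w := w) hd hn
  have hN := iterBound_le (w := w)
  have hC := codeBound_le_iterBound (w := w)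
  have hbase := base_le (w := w) hd hn
  have hW := sumSq_lt_base (w := w) hn
  refine Run.seq (Run.assign_nat 0 (by simp) (by omega) ?_)
  refine (Run.for (fun k s => s.arr aIn = (input w).arr aIn ∧
      s.var vW = (∑ p ∈ Finset.range k, ((input w).arr 0 p).natAbs ^ 2 : ℕ))
    (by simpa using hs) b5 (by omega) rfl rfl (by decide) (by simpa using hin) ?_).mono
    fun s' _ _ h => h.2
  rintro k hk s' hf hi ⟨h1, h2⟩
  refine Run.assign_nat (∑ p ∈ Finset.range (k + 1), ((input w).arr 0 p).natAbs ^ 2) ?_ ?_ ?_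
  · simp [h1, h2, hi, Finset.sum_range_succ, pow_two]
  · have : ∑ p ∈ Finset.range (k + 1), ((input w).arr 0 p).natAbs ^ 2 ≤ sumSq w :=
      Finset.sum_le_sum_of_subset (Finset.range_subset_range.2 hk)
    omega
  · simp [h1]

theorem run_bits (hd : 0 < d) (hn : 0 < n) {s : State} (hnn : s.var vNN = (n * n : ℕ))
    (h2n : s.var vTwoN = (2 * n : ℕ)) :
    Run O ω (iterBound w) (valueBound w) bitsProg s fun s =>
      s.var vCube = (2 ^ numBits n : ℕ) ∧ s.var vBits = numBits n := by
  obtain ⟨b1, b2, b3, b4, b5, b6, b7⟩ := le_iterBound (w := w) hd hn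
  have hN := iterBound_le (w := w)
  have hC := codeBound_le_iterBound (w := w)
  have hq := two_pow_le (w := w) hn
  refine Run.seq (Run.assign_nat 1 (by simp) (by omega) ?_)
  refine Run.seq (Run.assign_nat 0 (by simp) (by omega) ?_)
  refine (Run.for (fun k s => s.var vNN = (n * n : ℕ) ∧
      s.var vCube = (2 ^ min k (numBits n) : ℕ) ∧ s.var vBits = (min k (numBits n) : ℕ))
    (by simpa using h2n) b4 (by omega) rfl rfl (by decide) (by simpa using hnn) ?_).mono
    fun s' _ _ h => ?_
  · rintro k hk s' hf hi ⟨h1, h2, h3⟩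
    have hlt : 2 ^ min k (numBits n) + 1 ≤ 2 * (n * n) ↔ k < numBits n := by
      rw [Nat.succ_le_iff, ← Nat.lt_clog_iff_pow_lt (by norm_num)]
      change _ < numBits n ↔ _
      omega
    refine Run.seq (Run.assign_nat (if k < numBits n then 1 else 0) ?_
      (by split_ifs <;> omega) ?_)
    · simp only [val_leq, val_add, val_mul, val_var, val_one, val_two, h1, h2]
      norm_cast
      simp only [hlt]
    have hle : 2 ^ min (k + 1) (numBits n) ≤ 2 ^ numBits n :=
      Nat.pow_le_pow_right (by norm_num) (min_le_right _ _)
    refine Run.seq (Run.assign_nat (2 ^ min (k + 1) (numBits n)) ?_ (by omega) ?_)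
    · simp only [val_add, val_mul, val_var, State.setVar_var, h2]
      by_cases hkb : k < numBits n
      · simp [hkb, min_eq_left hkb.le, pow_succ, mul_two]
      · simp [hkb, min_eq_right (not_lt.1 hkb), min_eq_right ((not_lt.1 hkb).trans (Nat.le_succ k))]
    refine Run.assign_nat (min (k + 1) (numBits n)) ?_ (by omega) ?_
    · simp only [val_add, val_var, State.setVar_var, h3]
      norm_num
      split_ifs <;> omega
    · simp [h1]
  · rw [min_eq_right (numBits_le n)] at h
    exact h.2

theorem run_base (hd : 0 < d) (hn : 0 < n) {s : State} (hsn : s.var vN = n)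
    (hsd : s.var vD = d) (hw : s.var vW = sumSq w) :
    Run O ω (iterBound w) (valueBound w) baseProg s fun s =>
      s.var vBase = base w ∧ s.var vBaseD = (base w ^ d : ℕ) := by
  obtain ⟨b1, b2, b3, b4, b5, b6, b7⟩ := le_iterBound (w := w) hd hn
  have hN := iterBound_le (w := w)
  have hC := codeBound_le_iterBound (w := w)
  have hbase := base_le (w := w) hd hn
  refine Run.seq (Run.assign_nat (base w) (by simp [hsn, hw, base]) (by omega) ?_)
  refine Run.seq (Run.assign_nat 1 (by simp) (by omega) ?_)
  refine Run.for (fun k s => s.var vBase = base w ∧ s.var vBaseD = (base w ^ k : ℕ))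
    (by simpa using hsd) b1 (by omega) rfl rfl (by decide) (by simp) ?_
  rintro k hk s' hf hi ⟨h1, h2⟩
  have := base_pow_le (w := w) hn (show k + 1 ≤ _ from hk)
  refine Run.assign_nat (base w ^ (k + 1)) (by simp [h1, h2, pow_succ]) (by omega) ?_
  simp [h1]

theorem bigBase_le (hn : 0 < n) : bigBase n ≤ valueBound w := by
  simpa using bigBase_pow_le (w := w) (c := 1) hn (codeBound_pos hn)

theorem run_bigBase (hd : 0 < d) (hn : 0 < n) {s : State} (hsn : s.var vN = n)
    (hb : s.var vBaseD = (base w ^ d : ℕ)) (hq : s.var vCube = (2 ^ numBits n : ℕ)) :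
    Run O ω (iterBound w) (valueBound w) bigBaseProg s fun s =>
      s.var vH = (n ^ n : ℕ) ∧ s.var vK = bigBase n ∧ s.var vQ = scale n ∧
        s.var vC = codeBound w := by
  obtain ⟨b1, b2, b3, b4, b5, b6, b7⟩ := le_iterBound (w := w) hd hn
  have hN := iterBound_le (w := w)
  have hC := codeBound_le_iterBound (w := w)
  have hK := bigBase_le (w := w) hn
  have hnn : n ^ n ≤ valueBound w := by unfold bigBase at hK; omega
  have hQ := scale_le (w := w)
  refine Run.seq (Run.assign_nat 1 (by simp) (by omega) ?_)
  refine Run.seq ((Run.for (fun k s => s.var vN = n ∧ s.var vH = (n ^ k : ℕ))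
    (by simpa using hsn) b2 (by omega) rfl rfl (by decide) (by simpa using hsn) ?_).mono
    fun s' hf _ h => ?_)
  · rintro k hk s' hf hi ⟨h1, h2⟩
    have := Nat.pow_le_pow_right hn (show k + 1 ≤ _ from hk)
    refine Run.assign_nat (n ^ (k + 1)) (by simp [h1, h2, pow_succ]) (by omega) ?_
    simp [h1]
  have hb' : s'.var vBaseD = (base w ^ d : ℕ) := by rw [hf.var rfl]; simpa using hb
  have hq' : s'.var vCube = (2 ^ numBits n : ℕ) := by rw [hf.var rfl]; simpa using hq
  refine Run.seq (Run.assign_nat (bigBase n) (by simp [h.2, bigBase]) (by omega) ?_)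
  refine Run.seq (Run.assign_nat (scale n) (by simp [h.1, hq', scale]) (by omega) ?_)
  refine Run.assign_nat (codeBound w) (by simp [hb', codeBound]) (by omega) ?_
  simp [h.2]

theorem run_powers (hn : 0 < n) {s : State} (hk : s.var vK = bigBase n)
    (hc : s.var vC = codeBound w) :
    Run O ω (iterBound w) (valueBound w) powersProg s fun s =>
      s.var vHalf = (bigBase n : ℤ) ^ codeBound w / 2 ∧
        ∀ c : ℕ, c < codeBound w → s.arr aPow c = (bigBase n : ℤ) ^ c := by
  have hN := iterBound_le (w := w)
  have hC := codeBound_le_iterBound (w := w)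
  have hpow := fun c => bigBase_pow_le (w := w) (c := c) hn
  have h1 := hpow 0 (Nat.zero_le _)
  refine Run.seq (Run.assign_nat 1 (by simp) (by simpa using h1) ?_)
  refine Run.seq ((Run.for (fun k s => s.var vK = bigBase n ∧ s.var vTop = (bigBase n ^ k : ℕ) ∧
      ∀ c : ℕ, c < k → s.arr aPow c = (bigBase n : ℤ) ^ c)
    (by simpa using hc) hC (by omega) rfl rfl (by decide) (by simpa using hk) ?_).mono
    fun s' hf _ h => ?_)
  · rintro k hk s' hf hi ⟨h1, h2, h3⟩
    refine Run.seq (Run.store_eq k ((bigBase n ^ k : ℕ) : ℤ) (by simp [hi]) (by simp [h2])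
      (by rw [Nat.abs_cast, Nat.cast_le]; exact hpow k hk.le) ?_)
    refine Run.assign_nat (bigBase n ^ (k + 1)) (by simp [h1, h2, pow_succ]) (hpow _ hk) ?_
    refine ⟨by simpa using h1, by simp, fun c hc => ?_⟩
    rcases Nat.lt_succ_iff_lt_or_eq.1 hc with hc | rfl
    · simpa [hc.ne] using h3 c hc
    · simp
  · refine Run.assign_nat (bigBase n ^ codeBound w / 2) (by simp [h.2.1])
      ((Nat.div_le_self _ _).trans (hpow _ le_rfl)) ?_
    simpa using h.2.2

theorem run_setup (hd : 0 < d) (hn : 0 < n) :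
    Run O ω (iterBound w) (valueBound w) (setupProg d) (input w) fun s =>
      Setup w s ∧ s.coins = 0 ∧ ∀ p, s.arr aT p = 0 := by
  refine Run.seq ((run_count hd hn (by simp [input])).mono fun s₁ f₁ _ ⟨h1, h2, h3, h4⟩ => ?_)
  refine Run.seq ((run_sumSq hd hn h3 (f₁.arr rfl)).mono fun s₂ f₂ _ h5 => ?_)
  refine Run.seq ((run_bits hd hn (by rw [f₂.var rfl, h1]) (by rw [f₂.var rfl, h4])).mono
    fun s₃ f₃ _ ⟨h6, h7⟩ => ?_)
  have hn3 : s₃.var vN = n := by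
    rw [f₃.var rfl, f₂.var rfl, f₁.var rfl]; simp [input]
  have hd3 : s₃.var vD = d := by rw [f₃.var rfl, f₂.var rfl, h2]
  have hw3 : s₃.var vW = sumSq w := by rw [f₃.var rfl, h5]
  refine Run.seq ((run_base hd hn hn3 hd3 hw3).mono fun s₄ f₄ _ ⟨h8, h9⟩ => ?_)
  refine Run.seq ((run_bigBase hd hn (by rw [f₄.var rfl, hn3]) h9 (by rw [f₄.var rfl, h6])).mono
    fun s₅ f₅ _ ⟨h10, h11, h12, h13⟩ => ?_)
  refine (run_powers hn h11 h13).mono fun s f _ ⟨h14, h15⟩ => ?_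
  refine ⟨⟨?_, ?_, ?_, ?_, ?_, ?_, ?_, ?_, ?_, ?_, h14, ?_, h15⟩, ?_, ?_⟩
  · rw [f.var rfl, f₅.var rfl, f₄.var rfl, hn3]
  · rw [f.var rfl, f₅.var rfl, f₄.var rfl, hw3]
  · rw [f.var rfl, f₅.var rfl, f₄.var rfl, f₃.var rfl, f₂.var rfl, h1]
  · rw [f.var rfl, f₅.var rfl, f₄.var rfl, hd3]
  · rw [f.var rfl, f₅.var rfl, f₄.var rfl, h7]
  · rw [f.var rfl, f₅.var rfl, h8]
  · rw [f.var rfl, h10]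
  · rw [f.var rfl, h11]
  · rw [f.var rfl, h12]
  · rw [f.var rfl, h13]
  · rw [f.arr rfl, f₅.arr rfl, f₄.arr rfl, f₃.arr rfl, f₂.arr rfl, f₁.arr rfl]
  · rw [f.coins rfl, f₅.coins rfl, f₄.coins rfl, f₃.coins rfl, f₂.coins rfl, f₁.coins rfl]
    rfl
  · intro p
    rw [f.arr rfl, f₅.arr rfl, f₄.arr rfl, f₃.arr rfl, f₂.arr rfl, f₁.arr rfl]
    simp [input]

end Setup

theorem Setup.setVar {d n : ℕ} {w : Fin d → Fin n → Fin n → ℤ} {s : State} (h : Setup w s) {x : ℕ}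
    (hx : (Prog.assign x 0).keepsSetup = true) (v : ℤ) : Setup w (s.setVar x v) :=
  h.frame ⟨fun k => by simp [Prog.keepsVar] at k; simp [Ne.symm k], fun _ => rfl, fun _ => rfl⟩ hx

/-! ### The encoded weights -/

section Codes

variable {d n : ℕ} (w : Fin d → Fin n → Fin n → ℤ)

/-- The digits of the encoded weight vector of an edge: the weights, shifted to be nonnegative. -/
def vecDigit (i j : Fin n) (k : ℕ) : ℕ :=
  ((input w).arr 0 (k * (n * n) + edgeIdx i j : ℕ) + sumSq w).toNat

/-- The encoded weight vector of an edge. -/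
def vecCode (i j : Fin n) : ℕ := ∑ k ∈ Finset.range d, vecDigit w i j k * base w ^ k

/-- The exponent of `K` in the matrix: the encoded weight vector, perturbed by the random weight. -/
def edgeCode (ω : ℕ → Bool) (i j : Fin n) : ℕ :=
  vecCode w i j * scale n + randWeight ω (numBits n) i j

/-- The encoded weight vector of a perfect matching. -/
def permVec (σ : Equiv.Perm (Fin n)) : ℕ := ∑ i, vecCode w i (σ i)

/-- The encoded and perturbed weight of a perfect matching. -/
def permCode (ω : ℕ → Bool) (σ : Equiv.Perm (Fin n)) : ℕ := ∑ i, edgeCode w ω i (σ i)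

variable {w}

theorem input_apply {k : ℕ} (hk : k < d) (i j : Fin n) :
    (input w).arr 0 (k * (n * n) + edgeIdx i j : ℕ) = w ⟨k, hk⟩ i j := by
  rw [← input_arr w ⟨k, hk⟩ i j]
  congr 2
  simp only [position, edgeIdx]
  ring

theorem abs_le_sumSq (k : Fin d) (i j : Fin n) : |w k i j| ≤ sumSq w := by
  have hlt : (k : ℕ) * (n * n) + edgeIdx i j < d * (n * n) := by
    have h1 := Nat.mul_le_mul_right (n * n) (Nat.succ_le_of_lt k.isLt)
    have h2 := edgeIdx_lt i j
    rw [Nat.succ_mul] at h1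
    omega
  have h := Finset.single_le_sum (f := fun p : ℕ => ((input w).arr 0 p).natAbs ^ 2)
    (fun _ _ => Nat.zero_le _) (Finset.mem_range.2 hlt)
  simp only [input_apply k.isLt] at h
  have h3 : (w k i j).natAbs ≤ (w k i j).natAbs ^ 2 := Nat.le_self_pow two_ne_zero _
  have h4 : (w k i j).natAbs ≤ sumSq w := h3.trans h
  rw [Int.abs_eq_natAbs]
  exact_mod_cast h4

theorem vecDigit_cast {k : ℕ} (hk : k < d) (i j : Fin n) :
    (vecDigit w i j k : ℤ) = w ⟨k, hk⟩ i j + sumSq w := by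
  have := abs_le.1 (abs_le_sumSq (w := w) ⟨k, hk⟩ i j)
  rw [vecDigit, input_apply hk, Int.toNat_of_nonneg (by omega)]

theorem vecDigit_le {k : ℕ} (hk : k < d) (i j : Fin n) : vecDigit w i j k ≤ 2 * sumSq w := by
  have := abs_le.1 (abs_le_sumSq (w := w) ⟨k, hk⟩ i j)
  have := vecDigit_cast (w := w) hk i j
  omega

theorem sum_digits_lt_nat {K m : ℕ} {a : ℕ → ℕ} (ha : ∀ i < m, a i < K) :
    ∑ i ∈ Finset.range m, a i * K ^ i < K ^ m := by
  have := (sum_digits_lt (K := K) (a := fun i => a i) (m := m)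
    fun i hi => ⟨by positivity, by exact_mod_cast ha i hi⟩).2
  exact_mod_cast this

theorem sum_vecDigit_lt (hn : 0 < n) {m : ℕ} (hm : m ≤ d) (i j : Fin n) :
    ∑ k ∈ Finset.range m, vecDigit w i j k * base w ^ k < base w ^ m := by
  refine sum_digits_lt_nat fun k hk => ?_
  have := vecDigit_le (w := w) (hk.trans_le hm) i j
  have : 2 * sumSq w ≤ 2 * n * sumSq w := Nat.mul_le_mul_right _ (by omega)
  unfold base
  omega

theorem permVec_eq (σ : Equiv.Perm (Fin n)) :
    permVec w σ = ∑ k ∈ Finset.range d, (∑ i, vecDigit w i (σ i) k) * base w ^ k := by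
  simp only [permVec, vecCode, Finset.sum_mul]
  rw [Finset.sum_comm]

theorem sum_vecDigit_lt_base (σ : Equiv.Perm (Fin n)) {k : ℕ} (hk : k < d) :
    ∑ i, vecDigit w i (σ i) k < base w := by
  have := Finset.sum_le_card_nsmul Finset.univ (fun i => vecDigit w i (σ i) k) (2 * sumSq w)
    fun i _ => vecDigit_le hk i (σ i)
  simp only [Finset.card_univ, Fintype.card_fin, smul_eq_mul] at this
  unfold base
  nlinarith

theorem permVec_lt (σ : Equiv.Perm (Fin n)) : permVec w σ < base w ^ d := by
  rw [permVec_eq]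
  exact sum_digits_lt_nat fun k hk => sum_vecDigit_lt_base σ hk

theorem randWeight_lt (ω : ℕ → Bool) (i j : Fin n) :
    randWeight ω (numBits n) i j < 2 ^ numBits n := randNum_lt _ _ _

theorem mul_add_lt_codeBound {v u : ℕ} (hv : v < base w ^ d) (hu : u < scale n) :
    v * scale n + u < codeBound w := by
  have := Nat.mul_le_mul_right (scale n) (Nat.succ_le_of_lt hv)
  rw [Nat.succ_mul] at this
  rw [codeBound, mul_comm (scale n)]
  omega

theorem edgeCode_lt (ω : ℕ → Bool) (i j : Fin n) : edgeCode w ω i j < codeBound w :=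
  mul_add_lt_codeBound (sum_vecDigit_lt i.pos le_rfl i j)
    ((randWeight_lt ω i j).trans_le (Nat.le_mul_of_pos_left _ i.pos))

theorem permCode_eq (ω : ℕ → Bool) (σ : Equiv.Perm (Fin n)) :
    permCode w ω σ = permVec w σ * scale n + permWeight (randWeight ω (numBits n)) σ := by
  simp only [permCode, edgeCode, permVec, permWeight, Finset.sum_add_distrib, Finset.sum_mul]

theorem permWeight_lt (hn : 0 < n) (ω : ℕ → Bool) (σ : Equiv.Perm (Fin n)) :
    permWeight (randWeight ω (numBits n)) σ < scale n := by
  have : Nonempty (Fin n) := ⟨⟨0, hn⟩⟩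
  have := Finset.sum_lt_sum_of_nonempty (s := Finset.univ) Finset.univ_nonempty
    fun i _ => randWeight_lt ω i (σ i)
  simpa [permWeight, scale] using this

theorem permCode_lt (hn : 0 < n) (ω : ℕ → Bool) (σ : Equiv.Perm (Fin n)) :
    permCode w ω σ < codeBound w := by
  rw [permCode_eq]
  exact mul_add_lt_codeBound (permVec_lt σ) (permWeight_lt hn ω σ)

theorem permCode_div (hn : 0 < n) (ω : ℕ → Bool) (σ : Equiv.Perm (Fin n)) :
    permCode w ω σ / scale n = permVec w σ := by
  rw [permCode_eq, add_comm, Nat.add_mul_div_right _ _ (scale_pos hn),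
    Nat.div_eq_of_lt (permWeight_lt hn ω σ), zero_add]

end Codes

section Runs

variable {d n : ℕ} {w : Fin d → Fin n → Fin n → ℤ}
  {O : (Fin d → ℤ) → (Fin d → ℤ) → Prop} {ω : ℕ → Bool}

/-! ### The matrix -/

theorem run_matrix (hd : 0 < d) (hn : 0 < n) {s : State} (hs : Setup w s) (hc : s.coins = 0) :
    Run O ω (iterBound w) (valueBound w) matrixProg s fun s =>
      ∀ i j : Fin n, s.arr aA (edgeIdx i j) = (bigBase n : ℤ) ^ edgeCode w ω i j := by
  obtain ⟨b1, b2, b3, b4, b5, b6, b7⟩ := le_iterBound (w := w) hd hn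
  have hN := iterBound_le (w := w)
  have hC := codeBound_le_iterBound (w := w)
  refine (Run.for (fun k s => s.coins = k * numBits n ∧ ∀ i j : Fin n, edgeIdx i j < k →
      s.arr aA (edgeIdx i j) = (bigBase n : ℤ) ^ edgeCode w ω i j) hs.nn_eq b3 (by omega)
    rfl rfl (by decide) (by simpa using hc) ?_).mono fun s' _ _ h i j => h.2 i j (edgeIdx_lt i j)
  rintro k hk s' hf hi ⟨h1, h2⟩
  obtain ⟨i, j, rfl⟩ := exists_edgeIdx hk
  have hS := hs.frame hf rfl
  -- the encoded weight vector
  refine Run.seq (Run.assign_nat 0 (by simp) (by omega) ?_)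
  refine Run.seq (Run.assign_nat 1 (by simp) (by omega) ?_)
  refine Run.seq ((Run.for (fun m s => Setup w s ∧ s.var vI = (edgeIdx i j : ℕ) ∧
      s.var vAcc = (∑ k ∈ Finset.range m, vecDigit w i j k * base w ^ k : ℕ) ∧
      s.var vPow = (base w ^ m : ℕ))
    (by simpa using hS.d_eq) b1 (by omega) rfl rfl (by decide) ?_ ?_).mono
      fun s₁ f₁ _ ⟨_, g1, g2, g3⟩ => ?_)
  · refine ⟨((hS.setVar rfl _).setVar rfl _).setVar rfl _, by simpa using hi, by simp, by simp⟩
  · rintro m hm s₁ - hj ⟨g0, g1, g2, g3⟩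
    have hlt := sum_vecDigit_lt (w := w) hn (show m + 1 ≤ d from hm) i j
    have hle := base_pow_le (w := w) hn (show m + 1 ≤ d from hm)
    have hin : s₁.arr aIn (m * (n * n) + edgeIdx i j : ℕ) + sumSq w = vecDigit w i j m := by
      rw [g0.in_eq, vecDigit_cast hm, input_apply hm]
    refine Run.seq (Run.assign_nat
      (∑ k ∈ Finset.range (m + 1), vecDigit w i j k * base w ^ k) ?_ (by omega) ?_)
    · push_cast at hin
      simp [g0.nn_eq, g0.w_eq, g1, g2, g3, hj, hin, Finset.sum_range_succ]
    refine Run.assign_nat (base w ^ (m + 1)) (by simp [g0.base_eq, g3, pow_succ]) (by omega) ?_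
    exact ⟨((g0.setVar rfl _).setVar rfl _).setVar rfl _, by simpa using g1, by simp, by simp⟩
  -- the random weight
  have hS₁ : Setup w s₁ := ((hS.setVar rfl _).setVar rfl _).frame f₁ rfl
  have hcoins : s₁.coins = edgeIdx i j * numBits n := by rw [f₁.coins rfl]; simpa using h1
  have hA₁ : s₁.arr aA = s'.arr aA := by rw [f₁.arr rfl]; simp
  refine Run.seq (Run.assign_nat 0 (by simp) (by omega) ?_)
  refine Run.seq ((Run.for (fun r s => s.coins = edgeIdx i j * numBits n + r ∧
      s.var vU = (randNum ω (edgeIdx i j * numBits n) r : ℕ))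
    (by simpa using hS₁.bits_eq) b6 (by omega) rfl rfl (by decide) ?_ ?_).mono
      fun s₂ f₂ _ ⟨g4, g5⟩ => ?_)
  · simp [hcoins, randNum]
  · rintro r hr s₂ - hj ⟨g4, g5⟩
    refine Run.seq (Run.toss (by omega) ?_)
    have hlt := randNum_lt ω (edgeIdx i j * numBits n) (r + 1)
    have hle := Nat.pow_le_pow_right (n := 2) (by norm_num) (show r + 1 ≤ numBits n from hr)
    have hq := two_pow_le (w := w) hn
    refine Run.assign_nat (randNum ω (edgeIdx i j * numBits n) (r + 1)) ?_ (by omega) ?_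
    · simp only [val_add, val_mul, val_two, val_var, State.setVar_var, g4, g5, randNum]
      cases ω (edgeIdx i j * numBits n + r) <;> simp
    · simp [g4, add_assoc]
  -- the entry
  have hS₂ : Setup w s₂ := (hS₁.setVar rfl _).frame f₂ rfl
  have hI : s₂.var vI = edgeIdx i j := by rw [f₂.var rfl]; simpa using g1
  have hAcc : s₂.var vAcc = vecCode w i j := by
    rw [f₂.var rfl, State.setVar_var, if_neg (by decide), g2, vecCode]
  have hU : s₂.var vU = randWeight ω (numBits n) i j := g5
  have hA₂ : s₂.arr aA = s'.arr aA := by rw [f₂.arr rfl]; simpa using hA₁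
  have hlt := edgeCode_lt (w := w) ω i j
  refine Run.store_eq (edgeIdx i j) ((bigBase n : ℤ) ^ edgeCode w ω i j) (by simp [hI]) ?_ ?_ ?_
  · rw [← hS₂.pow_eq _ hlt]
    simp [hAcc, hU, hS₂.q_eq, edgeCode]
  · have := bigBase_pow_le (w := w) hn hlt.le
    rw [abs_of_nonneg (by positivity)]
    exact_mod_cast this
  · refine ⟨by simp [g4]; ring, forall_edgeIdx_succ (fun i' j' h => ?_) (by simp)⟩
    have hne : (edgeIdx i' j' : ℤ) ≠ edgeIdx i j := by exact_mod_cast h.ne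
    simpa [hne, hA₂] using h2 i' j' h

/-! ### Determinant and adjugate -/

/-- The partial sums of a sum over `Fin n`. -/
def finSum (g : Fin n → ℤ) (k : ℕ) : ℤ :=
  ∑ l ∈ Finset.range k, if h : l < n then g ⟨l, h⟩ else 0

theorem finSum_succ (g : Fin n → ℤ) (l : Fin n) : finSum g (l + 1) = finSum g l + g l := by
  simp [finSum, Finset.sum_range_succ]

theorem finSum_self (g : Fin n → ℤ) : finSum g n = ∑ l, g l := by
  rw [finSum, Finset.sum_range]
  exact Finset.sum_congr rfl fun l _ => by simp

theorem abs_finSum_le {g : Fin n → ℤ} {β : ℤ} (hβ : 0 ≤ β) (hg : ∀ l, |g l| ≤ β) {k : ℕ}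
    (hk : k ≤ n) : |finSum g k| ≤ n * β := by
  refine (Finset.abs_sum_le_sum_abs _ _).trans ?_
  refine (Finset.sum_le_card_nsmul _ _ β fun l _ => ?_).trans ?_
  · split_ifs
    · exact hg _
    · simpa using hβ
  · rw [Finset.card_range, nsmul_eq_mul]
    exact mul_le_mul_of_nonneg_right (by exact_mod_cast hk) hβ

open Matrix in
/-- One step of the recursion leads from the coefficients of index `k + 1` to those of index `k`.
The array `aT` holds the product of `A` and the coefficient matrix, which serves both the trace and
the next step. -/
theorem run_step {N R : ℕ} {A : Matrix (Fin n) (Fin n) ℤ} {a : ℤ} (ha : 1 ≤ a)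
    (hA : ∀ i j, |A i j| ≤ a) (hN : n * n ≤ N) (hNR : N ≤ R)
    (hR : (2 * n ^ 3 * a ^ 2) ^ (n + 1) ≤ (R : ℤ)) {k m : ℕ} (hkm : k + (m + 1) = n) {s : State}
    (hsn : s.var vN = n) (hsnn : s.var vNN = (n * n : ℕ)) (hsm : s.var vM = m)
    (hsA : ∀ i j : Fin n, s.arr aA (edgeIdx i j) = A i j)
    (hsT : ∀ i j : Fin n, s.arr aT (edgeIdx i j) = (A * adjCoeff A (k + 1)) i j)
    (hsP : s.var vP = A.charpoly.coeff (k + 1)) :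
    Run O ω N R stepProg s fun s =>
      (∀ i j : Fin n, s.arr aB (edgeIdx i j) = adjCoeff A k i j) ∧
      (∀ i j : Fin n, s.arr aT (edgeIdx i j) = (A * adjCoeff A k) i j) ∧
      s.var vP = A.charpoly.coeff k := by
  have hn : 0 < n := by omega
  have hn1 : (1 : ℤ) ≤ n := by omega
  have hnN : n ≤ N := (Nat.le_mul_of_pos_left n hn).trans hN
  set γ : ℤ := 2 * n ^ 3 * a ^ 2 with hγ
  have hγ1 : (n : ℤ) * (n * a) ≤ γ := by
    have h1 := mul_le_mul hn1 ha (by norm_num) (by omega)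
    have h2 : 0 ≤ (n : ℤ) ^ 2 * a := by positivity
    nlinarith
  have hna : (1 : ℤ) ≤ n * a := by nlinarith
  have hγ0 : (1 : ℤ) ≤ γ := by nlinarith
  -- `β` bounds the entries of the coefficient matrix
  set β : ℤ := γ ^ n with hβ
  have hβ1 : 1 ≤ β := one_le_pow₀ hγ0
  have hβR : n * (n * (a * β)) ≤ (R : ℤ) := by
    refine le_trans ?_ hR
    rw [pow_succ, ← hβ]
    calc n * (n * (a * β)) = (n * (n * a)) * β := by ring
      _ ≤ γ * β := mul_le_mul_of_nonneg_right hγ1 (by omega)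
      _ = β * γ := mul_comm _ _
  have haβ : 1 ≤ a * β := by nlinarith
  have hnaβ : n * (a * β) ≤ (R : ℤ) := by nlinarith
  have hβR' : β ≤ (R : ℤ) := by nlinarith
  have hpow : γ ^ (m + 1) ≤ β := pow_le_pow_right₀ hγ0 (by omega)
  have hB : ∀ i j, |adjCoeff A k i j| ≤ β := fun i j =>
    ((abs_adjCoeff_le A ha hA hn (m + 1) k hkm).1 i j).trans hpow
  have hP : |A.charpoly.coeff k| ≤ β :=
    (abs_adjCoeff_le A ha hA hn (m + 1) k hkm).2.trans hpow
  have hT : ∀ i j (l : Fin n), |A i l * adjCoeff A k l j| ≤ a * β := fun i j l => by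
    rw [abs_mul]
    exact mul_le_mul (hA _ _) (hB _ _) (abs_nonneg _) (by omega)
  have hAB : ∀ i j, |(A * adjCoeff A k) i j| ≤ n * (a * β) := fun i j => by
    rw [mul_apply, ← finSum_self]
    exact abs_finSum_le (by omega) (hT i j) le_rfl
  -- the coefficient matrix
  refine Run.seq ((Run.for (fun l s => ∀ i j : Fin n, edgeIdx i j < l →
      s.arr aB (edgeIdx i j) = adjCoeff A k i j) hsnn hN (by omega) rfl rfl (by decide)
      (by simp) ?_).mono fun s₁ f₁ _ h₁ => ?_)
  · rintro l hl s' hf hi h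
    obtain ⟨i, j, rfl⟩ := exists_edgeIdx hl
    refine Run.store_eq (edgeIdx i j) (adjCoeff A k i j) (by simp [hi]) ?_
      ((hB i j).trans hβR') ?_
    · have hn' : s'.var vN = n := by rw [hf.var rfl, hsn]
      have hT' : s'.arr aT (edgeIdx i j) = (A * adjCoeff A (k + 1)) i j := by
        rw [hf.arr rfl, hsT]
      have hP' : s'.var vP = A.charpoly.coeff (k + 1) := by rw [hf.var rfl, hsP]
      have hij : ((i : ℕ) : ℤ) = ((j : ℕ) : ℤ) ↔ i = j := by rw [Nat.cast_inj, Fin.ext_iff]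
      simp only [val_add, val_get, val_mul, val_var, val_equ, val_div, val_mod, hi, hn', hT', hP',
        edgeIdx_div, edgeIdx_mod, hij]
      rw [adjCoeff_eq A k, Matrix.add_apply, Matrix.smul_apply, one_apply, smul_eq_mul]
    · refine forall_edgeIdx_succ (fun i' j' hlt => ?_) (by simp)
      have hne : (edgeIdx i' j' : ℤ) ≠ edgeIdx i j := by exact_mod_cast hlt.ne
      simpa [hne] using h i' j' hlt
  have h₁' : ∀ i j : Fin n, s₁.arr aB (edgeIdx i j) = adjCoeff A k i j :=
    fun i j => h₁ i j (edgeIdx_lt i j)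
  have hn₁ : s₁.var vN = n := by rw [f₁.var rfl, hsn]
  have hm₁ : s₁.var vM = m := by rw [f₁.var rfl, hsm]
  have hnn₁ : s₁.var vNN = (n * n : ℕ) := by rw [f₁.var rfl, hsnn]
  have hA₁ : ∀ i j : Fin n, s₁.arr aA (edgeIdx i j) = A i j := by
    intro i j; rw [f₁.arr rfl, hsA]
  -- its product with `A`
  refine Run.seq ((Run.for (fun l s => ∀ i j : Fin n, edgeIdx i j < l →
      s.arr aT (edgeIdx i j) = (A * adjCoeff A k) i j) hnn₁ hN (by omega) rfl rfl (by decide)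
      (by simp) ?_).mono fun s₂ f₂ _ h₂ => ?_)
  · rintro l hl s' hf hi h
    obtain ⟨i, j, rfl⟩ := exists_edgeIdx hl
    have hn' : s'.var vN = n := by rw [hf.var rfl, hn₁]
    refine Run.seq (Run.assign_nat 0 (by simp) (by omega) ?_)
    refine Run.seq ((Run.for (fun l s => s.var vAcc =
        finSum (fun l => A i l * adjCoeff A k l j) l) (by simpa using hn') hnN (by omega) rfl rfl
        (by decide) (by simp [finSum]) ?_).mono fun s'' hf'' _ h'' => ?_)
    · rintro l hl s'' hf'' hj h''
      have hn'' : s''.var vN = n := by rw [hf''.var rfl]; simpa using hn'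
      have hi'' : s''.var vI = edgeIdx i j := by rw [hf''.var rfl]; simpa using hi
      have hA'' : s''.arr aA (edgeIdx i ⟨l, hl⟩) = A i ⟨l, hl⟩ := by
        rw [hf''.arr rfl, State.setVar_arr, hf.arr rfl, hA₁]
      have hB'' : s''.arr aB (edgeIdx ⟨l, hl⟩ j) = adjCoeff A k ⟨l, hl⟩ j := by
        rw [hf''.arr rfl, State.setVar_arr, hf.arr rfl, h₁']
      rw [edgeIdx_cast] at hA'' hB''
      have hsucc := finSum_succ (fun l => A i l * adjCoeff A k l j) ⟨l, hl⟩
      refine Run.assign_eq (finSum (fun l => A i l * adjCoeff A k l j) (l + 1)) ?_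
        ((abs_finSum_le (by omega) (hT i j) hl).trans hnaβ) ?_
      · simp only [val_add, val_mul, val_get, val_var, val_div, val_mod, hn'', hi'', hj, h'',
          edgeIdx_div, edgeIdx_mod]
        rw [hA'', hB'', hsucc]
      · simp
    · have hv : s''.var vAcc = (A * adjCoeff A k) i j := by
        rw [h'', finSum_self, mul_apply]
      refine Run.store_eq (edgeIdx i j) ((A * adjCoeff A k) i j) ?_ (by simp [hv])
        ((hAB i j).trans hnaβ) ?_
      · simp [hf''.var (x := vI) rfl, hi]
      · refine forall_edgeIdx_succ (fun i' j' hlt => ?_) (by simp)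
        have hne : (edgeIdx i' j' : ℤ) ≠ edgeIdx i j := by exact_mod_cast hlt.ne
        simpa [hne, hf''.arr (a := aT) rfl] using h i' j' hlt
  have h₂' : ∀ i j : Fin n, s₂.arr aT (edgeIdx i j) = (A * adjCoeff A k) i j :=
    fun i j => h₂ i j (edgeIdx_lt i j)
  have hn₂ : s₂.var vN = n := by rw [f₂.var rfl, hn₁]
  -- the trace of the product
  refine Run.seq (Run.assign_nat 0 (by simp) (by omega) ?_)
  refine Run.seq ((Run.for (fun l s => s.var vTr =
      finSum (fun l => (A * adjCoeff A k) l l) l) (by simpa using hn₂) hnN (by omega) rfl rfl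
      (by decide) (by simp [finSum]) ?_).mono fun s₃ f₃ _ h₃ => ?_)
  · rintro l hl s' hf hi h
    have hn' : s'.var vN = n := by rw [hf.var rfl]; simpa using hn₂
    have hT' : s'.arr aT (edgeIdx ⟨l, hl⟩ ⟨l, hl⟩) = (A * adjCoeff A k) ⟨l, hl⟩ ⟨l, hl⟩ := by
      rw [hf.arr rfl, State.setVar_arr, h₂']
    rw [edgeIdx_cast] at hT'
    have hsucc := finSum_succ (fun l => (A * adjCoeff A k) l l) ⟨l, hl⟩
    refine Run.assign_eq (finSum (fun l => (A * adjCoeff A k) l l) (l + 1)) ?_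
      ((abs_finSum_le (mul_nonneg (by omega) (by omega)) (fun l => hAB l l) hl).trans hβR) ?_
    · simp only [val_add, val_mul, val_get, val_var, hn', hi, h]
      rw [hT', hsucc]
    · simp
  -- the coefficient of the characteristic polynomial
  have htr : -s₃.var vTr = (m + 1 : ℕ) * A.charpoly.coeff k := by
    rw [h₃, finSum_self, charpoly_coeff_mul A hkm, trace]; rfl
  refine Run.assign_eq (A.charpoly.coeff k) ?_ (hP.trans hβR') ?_
  · have hm₃ : s₃.var vM = m := by
      rw [f₃.var rfl, State.setVar_var, if_neg (by decide), f₂.var rfl, hm₁]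
    simp only [val_div, val_sub, val_add, val_zero, val_one, val_var, hm₃, zero_sub, htr]
    push_cast
    exact Int.mul_ediv_cancel_left _ (by omega)
  · refine ⟨fun i j => ?_, fun i j => ?_, by simp⟩
    · rw [State.setVar_arr, f₃.arr rfl, State.setVar_arr, f₂.arr rfl, h₁']
    · rw [State.setVar_arr, f₃.arr rfl, State.setVar_arr, h₂']

theorem run_adjugate {N R : ℕ} {A : Matrix (Fin n) (Fin n) ℤ} {a : ℤ} (ha : 1 ≤ a)
    (hA : ∀ i j, |A i j| ≤ a) (hn : 0 < n) (hN : n * n ≤ N) (hNR : N ≤ R)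
    (hR : (2 * n ^ 3 * a ^ 2) ^ (n + 1) ≤ (R : ℤ)) {s : State}
    (hsn : s.var vN = n) (hsnn : s.var vNN = (n * n : ℕ))
    (hsA : ∀ i j : Fin n, s.arr aA (edgeIdx i j) = A i j)
    (hsT : ∀ p, s.arr aT p = 0) :
    Run O ω N R adjugateProg s fun s =>
      (∀ i j : Fin n, s.arr aB (edgeIdx i j) = adjCoeff A 0 i j) ∧
      s.var vP = A.charpoly.coeff 0 := by
  have hnN : n ≤ N := (Nat.le_mul_of_pos_left n hn).trans hN
  refine Run.seq (Run.assign_nat 1 (by simp) (by omega) ?_)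
  refine (Run.for (fun m s =>
      (0 < m → ∀ i j : Fin n, s.arr aB (edgeIdx i j) = adjCoeff A (n - m) i j) ∧
      (∀ i j : Fin n, s.arr aT (edgeIdx i j) = (A * adjCoeff A (n - m)) i j) ∧
      s.var vP = A.charpoly.coeff (n - m)) (by simpa using hsn) hnN (by omega) rfl rfl (by decide)
      ?_ ?_).mono fun s' _ _ h => ?_
  · simp [hsT, adjCoeff_card, charpoly_coeff_card]
  · rintro m hm s' hf hi ⟨-, h2, h3⟩
    have hk : n - m = n - (m + 1) + 1 := by omega
    rw [hk] at h2 h3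
    refine (run_step ha hA hN hNR hR (by omega) (by rw [hf.var rfl]; simpa using hsn)
      (by rw [hf.var rfl]; simpa using hsnn) hi (by rw [hf.arr rfl]; simpa using hsA) h2 h3).mono
      fun s'' _ _ h => ?_
    simpa using h
  · simpa [hn] using And.intro (h.1 hn) h.2.2

end Runs

/-! ### Coefficients and digits of the determinant -/

section Coefficients

variable {d n : ℕ} (w : Fin d → Fin n → Fin n → ℤ) (ω : ℕ → Bool)

/-- The coefficient of `K ^ c` in the determinant: the signed number of perfect matchings of
encoded and perturbed weight `c`. -/
def detCoeff (c : ℕ) : ℤ :=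
  ∑ σ : Equiv.Perm (Fin n) with permCode w ω σ = c, signNeg σ

/-- The same coefficient for the perfect matchings that contain the edge `(i, j)`. -/
def edgeCoeff (c : ℕ) (i j : Fin n) : ℤ :=
  ∑ σ ∈ Finset.univ.filter (fun σ : Equiv.Perm (Fin n) => σ i = j) with permCode w ω σ = c,
    -signNeg σ

variable {w ω}

theorem exists_of_detCoeff_ne_zero {c : ℕ} (h : detCoeff w ω c ≠ 0) :
    ∃ σ, permCode w ω σ = c := by
  obtain ⟨σ, hσ, -⟩ := Finset.exists_ne_zero_of_sum_ne_zero h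
  exact ⟨σ, (Finset.mem_filter.1 hσ).2⟩

theorem detCoeff_ne_zero {σ : Equiv.Perm (Fin n)}
    (h : ∀ τ, permCode w ω τ = permCode w ω σ → τ = σ) : detCoeff w ω (permCode w ω σ) ≠ 0 := by
  have : (Finset.univ.filter fun τ => permCode w ω τ = permCode w ω σ) = {σ} := by
    ext τ
    simp only [Finset.mem_filter, Finset.mem_univ, true_and, Finset.mem_singleton]
    exact ⟨h τ, by rintro rfl; rfl⟩
  rw [detCoeff, this, Finset.sum_singleton]
  have := abs_signNeg σ
  intro h0
  simp [h0] at this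

theorem edgeCoeff_ne_zero_iff {σ : Equiv.Perm (Fin n)}
    (h : ∀ τ, permCode w ω τ = permCode w ω σ → τ = σ) (i j : Fin n) :
    edgeCoeff w ω (permCode w ω σ) i j ≠ 0 ↔ σ i = j := by
  constructor
  · intro h0
    obtain ⟨τ, hτ, -⟩ := Finset.exists_ne_zero_of_sum_ne_zero h0
    simp only [Finset.mem_filter, Finset.mem_univ, true_and] at hτ
    rw [← h τ hτ.2]
    exact hτ.1
  · rintro rfl
    have : ((Finset.univ.filter fun τ : Equiv.Perm (Fin n) => τ i = σ i).filter
        fun τ => permCode w ω τ = permCode w ω σ) = {σ} := by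
      ext τ
      simp only [Finset.mem_filter, Finset.mem_univ, true_and, Finset.mem_singleton]
      exact ⟨fun hτ => h τ hτ.2, by rintro rfl; exact ⟨rfl, rfl⟩⟩
    rw [edgeCoeff, this, Finset.sum_singleton]
    have := abs_signNeg σ
    intro h0
    rw [neg_eq_zero] at h0
    simp [h0] at this

/-- The program reads off the coefficients of sums of signed powers of `K`. -/
theorem val_digitExpr (hn : 0 < n) {s : State} (hs : Setup w s) {z c : Expr} {m : ℕ}
    (hm : m < codeBound w) (hc : c.val s = m) (S : Finset (Equiv.Perm (Fin n)))
    (e : Equiv.Perm (Fin n) → ℤ) (he : ∀ σ, |e σ| ≤ 1)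
    (hz : z.val s = ∑ σ ∈ S, e σ * (bigBase n : ℤ) ^ permCode w ω σ) :
    (digitExpr z c).val s = (n ^ n : ℕ) + ∑ σ ∈ S with permCode w ω σ = m, e σ := by
  have hK : (bigBase n : ℤ) = 2 * (n ^ n : ℕ) + 1 := by simp [bigBase]
  have hcard : S.card ≤ n ^ n := by
    refine (Finset.card_le_univ S).trans ?_
    rw [Fintype.card_perm, Fintype.card_fin]
    exact Nat.factorial_le_pow n
  simp only [digitExpr, val_mod, val_div, val_add, val_get, val_var, hc, hs.pow_eq m hm,
    hs.half_eq, hs.k_eq, hz, hK]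
  exact digit_signed_sum S e (permCode w ω) hcard (fun σ _ => he σ)
    (fun σ _ => permCode_lt hn ω σ) hm

variable (w) in
/-- The weight vector encoded by `v`. -/
def decode (v : ℕ) : Fin d → ℤ := fun k => ((v / base w ^ (k : ℕ) % base w : ℕ) : ℤ) - n * sumSq w

theorem decode_permVec (σ : Equiv.Perm (Fin n)) :
    decode w (permVec w σ) = fun k => ∑ i, w k i (σ i) := by
  funext k
  have h := digit_sum (K := base w) (C := d) (c := k)
    (fun l => ((∑ i, vecDigit w i (σ i) l : ℕ) : ℤ))
    (fun l hl => ⟨by positivity, by exact_mod_cast sum_vecDigit_lt_base σ hl⟩) k.isLt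
  have h2 : ((permVec w σ : ℕ) : ℤ) =
      ∑ l ∈ Finset.range d, ((∑ i, vecDigit w i (σ i) l : ℕ) : ℤ) * (base w : ℤ) ^ l := by
    rw [permVec_eq]; push_cast; rfl
  rw [← h2] at h
  have h3 : ((∑ i, vecDigit w i (σ i) k : ℕ) : ℤ) = ∑ i, w k i (σ i) + n * sumSq w := by
    push_cast
    simp [vecDigit_cast k.isLt, Finset.sum_add_distrib]
  rw [decode]
  push_cast at h h3 ⊢
  rw [h, h3]
  ring

end Coefficients

/-! ### The search for the best weight vector -/

/-- The quantity that is to be maximized. -/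
noncomputable def goalVal {d : ℕ} (goal : Goal) (f : (Fin d → ℝ) → ℝ) (y : Fin d → ℤ) : ℝ :=
  match goal with
  | .maximize => atInt f y
  | .minimize => -atInt f y

/-- The invariant of the search for the first maximum of `G` on the support of `D`: the positions
below `c` have been inspected, and `best` is the first maximum among them, if `flag` is set. -/
def SearchInv (D : ℕ → ℤ) (G : ℕ → ℝ) (c : ℕ) (flag : ℤ) (best : ℕ) : Prop :=
  flag = 0 ∧ best = 0 ∧ (∀ c' < c, D c' = 0) ∨
  flag = 1 ∧ best < c ∧ D best ≠ 0 ∧ (∀ c' < c, D c' ≠ 0 → G c' ≤ G best) ∧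
    ∀ c' < best, D c' ≠ 0 → G c' < G best

namespace SearchInv

variable {D : ℕ → ℤ} {G : ℕ → ℝ} {c : ℕ} {flag : ℤ} {best : ℕ}

theorem zero : SearchInv D G 0 0 0 := Or.inl ⟨rfl, rfl, by simp⟩

theorem keep (h : SearchInv D G c flag best)
    (hc : D c ≠ 0 → flag ≠ 0 ∧ G c ≤ G best) : SearchInv D G (c + 1) flag best := by
  rcases h with ⟨h1, h2, h3⟩ | ⟨h1, h2, h3, h4, h5⟩
  · refine Or.inl ⟨h1, h2, fun c' hc' => ?_⟩
    rcases Nat.lt_succ_iff_lt_or_eq.1 hc' with h | rfl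
    · exact h3 c' h
    · by_contra h0
      exact (hc h0).1 h1
  · refine Or.inr ⟨h1, by omega, h3, fun c' hc' h0 => ?_, h5⟩
    rcases Nat.lt_succ_iff_lt_or_eq.1 hc' with h | rfl
    · exact h4 c' h h0
    · exact (hc h0).2

theorem update (h : SearchInv D G c flag best) (hc : D c ≠ 0)
    (hb : flag ≠ 0 → G best < G c) : SearchInv D G (c + 1) 1 c := by
  have hlt : ∀ c' < c, D c' ≠ 0 → G c' < G c := by
    rcases h with ⟨h1, h2, h3⟩ | ⟨h1, h2, h3, h4, h5⟩
    · exact fun c' hc' h0 => absurd (h3 c' hc') h0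
    · exact fun c' hc' h0 => (h4 c' hc' h0).trans_lt (hb (by simp [h1]))
  refine Or.inr ⟨rfl, by omega, hc, fun c' hc' h0 => ?_, hlt⟩
  rcases Nat.lt_succ_iff_lt_or_eq.1 hc' with h | rfl
  · exact (hlt c' h h0).le
  · exact le_rfl

theorem best_lt (h : SearchInv D G c flag best) {C : ℕ} (hC : 0 < C) (hc : c ≤ C) : best < C := by
  rcases h with ⟨-, h2, -⟩ | ⟨-, h2, -⟩ <;> omega

/-- At the end of the search, a position that beats all others, and all earlier ones strictly, has
been found. -/
theorem eq_first_max (h : SearchInv D G c flag best) {c₀ : ℕ} (h0 : c₀ < c) (hD : D c₀ ≠ 0)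
    (hmax : ∀ c', D c' ≠ 0 → G c' ≤ G c₀) (hfirst : ∀ c' < c₀, D c' ≠ 0 → G c' < G c₀) :
    best = c₀ := by
  rcases h with ⟨-, -, h3⟩ | ⟨-, h2, h3, h4, h5⟩
  · exact absurd (h3 c₀ h0) hD
  · rcases lt_trichotomy best c₀ with hlt | rfl | hlt
    · exact absurd (h4 c₀ h0 hD) (not_le.2 (hfirst best hlt h3))
    · rfl
    · exact absurd (h5 c₀ hlt hD) (not_lt.2 (hmax best h3))

end SearchInv

section Runs

variable {d n : ℕ} {w : Fin d → Fin n → Fin n → ℤ} {ω : ℕ → Bool}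

open Classical in
theorem run_compare {N R : ℕ} (hR : 1 ≤ R) (goal : Goal) (f : (Fin d → ℝ) → ℝ) {s : State}
    {Q : State → Prop}
    (h : Q (s.setVar vX
      (if goalVal goal f (s.vec d aCand) ≤ goalVal goal f (s.vec d aBest) then 1 else 0))) :
    Run (comparisonOracle f) ω N R (compareProg goal) s Q := by
  cases goal with
  | maximize => exact Run.query hR h
  | minimize =>
    refine Run.query hR ?_
    simp only [goalVal, neg_le_neg_iff] at h
    convert h using 4
    rfl

theorem run_decode {O : (Fin d → ℤ) → (Fin d → ℤ) → Prop} (hd : 0 < d) (hn : 0 < n) {s : State}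
    (hs : Setup w s) {v v' : ℕ} (hv : v ≤ codeBound w) (hv' : v' ≤ codeBound w)
    (hS : s.var vS = v) (hT : s.var vT = v') :
    Run O ω (iterBound w) (valueBound w) decodeProg s fun s =>
      s.vec d aCand = decode w v ∧ s.vec d aBest = decode w v' := by
  obtain ⟨b1, b2, b3, b4, b5, b6, b7⟩ := le_iterBound (w := w) hd hn
  have hN := iterBound_le (w := w)
  have hC := codeBound_le_iterBound (w := w)
  have hbase := base_le (w := w) hd hn
  have hb0 := base_pos (w := w)
  have hW : n * sumSq w ≤ base w := by unfold base; nlinarith [Nat.zero_le (n * sumSq w)]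
  have hdig : ∀ x : ℕ, |((x % base w : ℕ) : ℤ) - n * sumSq w| ≤ (valueBound w : ℤ) := fun x => by
    have h1 := Nat.mod_lt x hb0
    have h2 : ((n * sumSq w : ℕ) : ℤ) = n * sumSq w := by push_cast; rfl
    rw [← h2, abs_le]
    omega
  have hdiv : ∀ x k, x ≤ codeBound w → x / base w ^ k ≤ valueBound w := fun x k hx =>
    (Nat.div_le_self _ _).trans (by omega)
  refine (Run.for (fun k s =>
      s.var vS = (v / base w ^ k : ℕ) ∧ s.var vT = (v' / base w ^ k : ℕ) ∧
      (∀ l : Fin d, (l : ℕ) < k → s.arr aCand (l : ℕ) = decode w v l) ∧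
      ∀ l : Fin d, (l : ℕ) < k → s.arr aBest (l : ℕ) = decode w v' l)
    hs.d_eq b1 (by omega) rfl rfl (by decide) (by simp [hS, hT]) ?_).mono
    fun s' _ _ h => ⟨funext fun l => h.2.2.1 l l.isLt, funext fun l => h.2.2.2 l l.isLt⟩
  rintro k hk s' hf hj ⟨h1, h2, h3, h4⟩
  have hS' := hs.frame hf rfl
  have hdivs : ∀ x : ℕ, ((x / base w ^ (k + 1) : ℕ) : ℤ) = (x / base w ^ k : ℕ) / (base w : ℤ) :=
    fun x => by rw [pow_succ, ← Nat.div_div_eq_div_mul]; push_cast; rfl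
  refine Run.seq (Run.store_eq k _ (by simp [hj])
    (by simp only [val_sub, val_mod, val_mul, val_var, h1, hS'.base_eq, hS'.n_eq, hS'.w_eq]; rfl)
    (hdig (v / base w ^ k)) ?_)
  refine Run.seq (Run.assign_nat (v / base w ^ (k + 1)) ?_ (hdiv _ _ hv) ?_)
  · simp only [hdivs, val_div, val_var, State.setArr_var, h1, hS'.base_eq]
  refine Run.seq (Run.store_eq k (((v' / base w ^ k % base w : ℕ) : ℤ) - n * sumSq w)
    (by simp [hj]) ?_ (hdig (v' / base w ^ k)) ?_)
  · simp [h2, hS'.base_eq, hS'.n_eq, hS'.w_eq]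
  refine Run.assign_nat (v' / base w ^ (k + 1)) ?_ (hdiv _ _ hv') ?_
  · rw [hdivs v']
    simp [h2, hS'.base_eq]
  refine ⟨by simp, by simp, fun l hl => ?_, fun l hl => ?_⟩
  · by_cases hlk : (l : ℕ) = k
    · simp [hlk, decode]
    · simpa [hlk] using h3 l (by omega)
  · by_cases hlk : (l : ℕ) = k
    · simp [hlk, decode]
    · simpa [hlk] using h4 l (by omega)

theorem run_search (hd : 0 < d) (hn : 0 < n) (goal : Goal) (f : (Fin d → ℝ) → ℝ) {s : State}
    (hs : Setup w s)
    (hP : s.var vP = ∑ σ : Equiv.Perm (Fin n), signNeg σ * (bigBase n : ℤ) ^ permCode w ω σ) :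
    Run (comparisonOracle f) ω (iterBound w) (valueBound w) (searchProg goal) s fun s =>
      ∃ (flag : ℤ) (best : ℕ), s.var vBest = best ∧
        SearchInv (detCoeff w ω) (fun c => goalVal goal f (decode w (c / scale n)))
          (codeBound w) flag best := by
  classical
  obtain ⟨b1, b2, b3, b4, b5, b6, b7⟩ := le_iterBound (w := w) hd hn
  have hN := iterBound_le (w := w)
  have hC := codeBound_le_iterBound (w := w)
  have hC0 := codeBound_pos (w := w) hn
  have hkeep : (searchProg goal).keepsSetup = true := by cases goal <;> rfl
  set G : ℕ → ℝ := fun c => goalVal goal f (decode w (c / scale n)) with hG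
  refine Run.seq (Run.assign_nat 0 (by simp) (by omega) ?_)
  refine Run.seq (Run.assign_nat 0 (by simp) (by omega) ?_)
  refine (Run.for (fun c s => ∃ best : ℕ, s.var vBest = best ∧
      SearchInv (detCoeff w ω) G c (s.var vFlag) best) (by simpa using hs.c_eq) hC (by omega)
    (by cases goal <;> rfl) (by cases goal <;> rfl) (by decide) ⟨0, by simp, by
      simpa using SearchInv.zero⟩ ?_).mono fun s' _ _ ⟨best, h1, h2⟩ => ⟨_, best, h1, h2⟩
  rintro c hc s₁ f₁ hi ⟨best, h1, h2⟩
  have hS₁ : Setup w s₁ := ((hs.setVar rfl _).setVar rfl _).frame f₁ (by cases goal <;> rfl)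
  have hP₁ : s₁.var vP = ∑ σ : Equiv.Perm (Fin n),
      signNeg σ * (bigBase n : ℤ) ^ permCode w ω σ := by
    rw [f₁.var (by cases goal <;> rfl)]; simpa using hP
  have hbest := h2.best_lt hC0 hc.le
  have hdigit := val_digitExpr (z := var vP) (c := var vI) hn hS₁ hc hi Finset.univ signNeg
    (fun σ => (abs_signNeg σ).le) hP₁
  have htest : (equ (digitExpr (var vP) (var vI)) (var vH)).val s₁ =
      if detCoeff w ω c = 0 then 1 else 0 := by
    rw [val_equ, hdigit, val_var, hS₁.h_eq, detCoeff]
    simp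
  refine Run.cond (fun ht => ?_) fun ht => ?_
  · have hD : detCoeff w ω c = 0 := by
      by_contra h0
      simp [htest, h0] at ht
    exact Run.skip ⟨best, by simpa using h1, by simpa using h2.keep fun h0 => absurd hD h0⟩
  have hD : detCoeff w ω c ≠ 0 := by
    intro h0
    simp [htest, h0] at ht
  have hcQ : c / scale n ≤ codeBound w := (Nat.div_le_self _ _).trans hc.le
  have hbQ : best / scale n ≤ codeBound w := (Nat.div_le_self _ _).trans hbest.le
  refine Run.seq (Run.assign_nat (c / scale n) (by simp [hi, hS₁.q_eq]) (by omega) ?_)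
  refine Run.seq (Run.assign_nat (best / scale n) (by simp [h1, hS₁.q_eq]) (by omega) ?_)
  refine Run.seq ((run_decode hd hn ((hS₁.setVar rfl _).setVar rfl _) hcQ hbQ (by simp)
    (by simp)).mono fun s₂ f₂ _ ⟨h3, h4⟩ => ?_)
  have hi₂ : s₂.var vI = c := by rw [f₂.var rfl]; simpa using hi
  have hb₂ : s₂.var vBest = best := by rw [f₂.var rfl]; simpa using h1
  have hfl₂ : s₂.var vFlag = s₁.var vFlag := by rw [f₂.var rfl]; simp
  refine Run.seq (Run.assign_nat 0 (by simp) (by omega) ?_)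
  -- afterwards `vX` says that there is a best vector already, and that it is not improved upon
  refine Run.seq ?_
  have hmid : Run (comparisonOracle f) ω (iterBound w) (valueBound w)
      (.cond (var vFlag) (compareProg goal) .skip) (s₂.setVar vX (0 : ℕ)) fun s₃ =>
        (s₃.var vX ≠ 0 ↔ s₁.var vFlag ≠ 0 ∧ G c ≤ G best) := by
    refine Run.cond (fun hflag => ?_) fun hflag => ?_
    · have hflag' : s₁.var vFlag ≠ 0 := by simpa [hfl₂] using hflag
      refine run_compare (by omega) goal f ?_
      have hc3 : (s₂.setVar vX (0 : ℕ)).vec d aCand = decode w (c / scale n) := h3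
      have hc4 : (s₂.setVar vX (0 : ℕ)).vec d aBest = decode w (best / scale n) := h4
      rw [hc3, hc4]
      simp [hflag', hG]
    · have hflag' : s₁.var vFlag = 0 := by simpa [hfl₂] using hflag
      exact Run.skip (by simp [hflag'])
  refine hmid.mono fun s₃ f₃ _ hX => ?_
  have hi₃ : s₃.var vI = c := by rw [f₃.var (by cases goal <;> rfl)]; simpa using hi₂
  have hb₃ : s₃.var vBest = best := by rw [f₃.var (by cases goal <;> rfl)]; simpa using hb₂
  have hfl₃ : s₃.var vFlag = s₁.var vFlag := by
    rw [f₃.var (by cases goal <;> rfl)]; simpa using hfl₂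
  refine Run.cond (fun hx => ?_) fun hx => ?_
  · exact Run.skip ⟨best, by simpa using hb₃, by simpa [hfl₃] using h2.keep fun _ => hX.1 hx⟩
  · refine Run.seq (Run.assign_nat 1 (by simp) (by omega) ?_)
    refine Run.assign_nat c (by simp [hi₃]) (by omega) ?_
    refine ⟨c, by simp, ?_⟩
    have := h2.update hD fun h0 => not_le.1 fun hle => hX.2 ⟨h0, hle⟩ hx
    simpa using this

/-! ### The output -/

/-- The output array holds the permutation `τ`. -/
def HoldsPerm (s : State) (τ : Equiv.Perm (Fin n)) : Prop :=
  ∀ i : Fin n, s.arr aOut (i : ℕ) = (τ i : ℕ)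

/-- Positions other than `i` whose entry is not `j` keep their entry. Later
iterations of the loop do no harm, as after the exchange only the entry at `i` equals `j`. -/
theorem run_swap {O : (Fin d → ℤ) → (Fin d → ℤ) → Prop} {N R : ℕ} (hnN : n ≤ N) (hNR : N ≤ R)
    {s : State} (hsn : s.var vN = n) {i j : Fin n} (hi : s.var vI = edgeIdx i j)
    {τ : Equiv.Perm (Fin n)} (hτ : HoldsPerm s τ) :
    Run O ω N R swapProg s fun s => ∃ ρ : Equiv.Perm (Fin n), HoldsPerm s ρ ∧ ρ i = j ∧
      ∀ x, x ≠ i → τ x ≠ j → ρ x = τ x := by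
  refine (Run.for (fun k s => ∃ ρ : Equiv.Perm (Fin n), HoldsPerm s ρ ∧
      (∀ l : Fin n, (l : ℕ) < k → ρ l = j → l = i) ∧ ∀ x, x ≠ i → τ x ≠ j → ρ x = τ x)
    hsn hnN (by omega) rfl rfl (by decide) ⟨τ, by simpa [HoldsPerm] using hτ, by simp, by simp⟩
    ?_).mono fun s' _ _ ⟨ρ, h1, h2, h3⟩ => ⟨ρ, h1, ?_, h3⟩
  · rintro k hk s' hf hj ⟨ρ, h1, h2, h3⟩
    obtain ⟨l, rfl⟩ : ∃ l : Fin n, (l : ℕ) = k := ⟨⟨k, hk⟩, rfl⟩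
    have hn' : s'.var vN = n := by rw [hf.var rfl, hsn]
    have hi' : s'.var vI = edgeIdx i j := by rw [hf.var rfl, hi]
    have hval : ∀ x : Fin n, |((x : ℕ) : ℤ)| ≤ (R : ℤ) := fun x => by
      rw [Nat.abs_cast, Nat.cast_le]; omega
    have htest : (equ (get aOut (var vJ)) (var vI % var vN)).val s' =
        if ρ l = j then 1 else 0 := by
      simp only [val_equ, val_get, val_var, val_mod, hj, hi', hn', edgeIdx_mod, h1 l]
      simp only [Nat.cast_inj, Fin.ext_iff]
    refine Run.cond (fun ht => ?_) fun ht => ?_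
    · have hl : ρ l = j := by
        by_contra h0
        simp [htest, h0] at ht
      refine Run.seq (Run.store_eq (l : ℕ) (ρ i : ℕ) (by simp [hj]) ?_ (hval _) ?_)
      · simp only [val_get, val_div, val_var, hi', hn', edgeIdx_div, h1 i]
      refine Run.store_eq (i : ℕ) (j : ℕ) ?_ ?_ (hval _) ?_
      · simp only [val_div, val_var, State.setArr_var, hi', hn', edgeIdx_div]
      · simp only [val_mod, val_var, State.setArr_var, hi', hn', edgeIdx_mod]
      refine ⟨ρ * Equiv.swap i l, fun x => ?_, fun l' _ hl' => ?_, fun x hx hxj => ?_⟩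
      · simp only [State.setVar_arr, State.setArr_arr, true_and, Nat.cast_inj, ← Fin.ext_iff,
          Equiv.Perm.mul_apply, Equiv.swap_apply_def]
        by_cases hxi : x = i
        · simp [hxi, hl]
        · by_cases hxl : x = l
          · subst hxl; simp [hxi]
          · simpa [hxi, hxl] using h1 x
      · have : (ρ * Equiv.swap i l) i = j := by simp [hl]
        exact (ρ * Equiv.swap i l).injective (hl'.trans this.symm)
      · have hxl : x ≠ l := by
          rintro rfl
          exact hxj (by rw [← h3 x hx hxj, hl])
        rw [Equiv.Perm.mul_apply, Equiv.swap_apply_of_ne_of_ne hx hxl, h3 x hx hxj]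
    · have hl : ρ l ≠ j := by
        intro h0
        simp [htest, h0] at ht
      refine Run.skip ⟨ρ, by simpa [HoldsPerm] using h1, fun l' hlt hl' => ?_, h3⟩
      rcases Nat.lt_succ_iff_lt_or_eq.1 hlt with h | h
      · exact h2 l' h hl'
      · exact absurd hl' (by rwa [Fin.ext h])
  · have h := h2 (ρ⁻¹ j) (Fin.isLt _) (by simp)
    rw [← h]; simp

/-- The output is a permutation in any case. If the nonzero coefficients at `best` are those of the
edges of a perfect matching, then it is this matching. -/
theorem run_output {O : (Fin d → ℤ) → (Fin d → ℤ) → Prop} (hd : 0 < d) (hn : 0 < n) {s : State}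
    (hs : Setup w s) {best : ℕ} (hb : best < codeBound w) (hbest : s.var vBest = best)
    (hA : ∀ i j : Fin n, s.arr aA (edgeIdx i j) * s.arr aB (edgeIdx j i) =
      ∑ σ : Equiv.Perm (Fin n) with σ i = j, -signNeg σ * (bigBase n : ℤ) ^ permCode w ω σ) :
    Run O ω (iterBound w) (valueBound w) outputProg s fun s =>
      ∃ τ : Equiv.Perm (Fin n), HoldsPerm s τ ∧
        ∀ σ : Equiv.Perm (Fin n), (∀ i j, edgeCoeff w ω best i j ≠ 0 ↔ σ i = j) → τ = σ := by
  obtain ⟨b1, b2, b3, b4, b5, b6, b7⟩ := le_iterBound (w := w) hd hn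
  have hN := iterBound_le (w := w)
  refine Run.seq ((Run.for (fun k s => ∀ i : Fin n, (i : ℕ) < k → s.arr aOut (i : ℕ) = (i : ℕ))
    hs.n_eq b2 (by omega) rfl rfl (by decide) (by simp) ?_).mono fun s₁ f₁ _ h₁ => ?_)
  · rintro k hk s' hf hi h
    refine Run.store_eq k k (by simp [hi]) (by simp [hi])
      (by rw [Nat.abs_cast, Nat.cast_le]; omega) fun i hik => ?_
    by_cases hik' : (i : ℕ) = k
    · simp [hik']
    · simpa [hik'] using h i (by omega)
  have hs₁ := hs.frame f₁ rfl
  refine (Run.for (fun k s => ∃ τ : Equiv.Perm (Fin n), HoldsPerm s τ ∧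
      ∀ σ : Equiv.Perm (Fin n), (∀ i j, edgeCoeff w ω best i j ≠ 0 ↔ σ i = j) →
        ∀ i, edgeIdx i (σ i) < k → τ i = σ i) hs₁.nn_eq b3 (by omega) rfl rfl (by decide)
      ⟨1, fun i => by simpa using h₁ i i.isLt, by simp⟩ ?_).mono
      fun s' _ _ ⟨τ, h1, h2⟩ => ⟨τ, h1, fun σ hσ => Equiv.ext fun i => h2 σ hσ i (edgeIdx_lt _ _)⟩
  rintro k hk s' hf hi ⟨τ, h1, h2⟩
  obtain ⟨i, j, rfl⟩ := exists_edgeIdx hk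
  have hs' := hs₁.frame hf rfl
  have hval : (get aA (var vI) * get aB (var vI % var vN * var vN + var vI / var vN)).val s' =
      ∑ σ : Equiv.Perm (Fin n) with σ i = j,
        -signNeg σ * (bigBase n : ℤ) ^ permCode w ω σ := by
    rw [← hA i j]
    simp only [val_mul, val_get, val_add, val_mod, val_div, val_var, hi, hs'.n_eq, edgeIdx_mod,
      edgeIdx_div, ← edgeIdx_cast]
    rw [hf.arr rfl, hf.arr rfl, f₁.arr rfl, f₁.arr rfl]
  have hdigit := val_digitExpr (c := var vBest) hn hs' hb
    (by rw [val_var, hf.var rfl, f₁.var rfl, hbest]) _ (fun σ => -signNeg σ)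
    (fun σ => by rw [abs_neg, abs_signNeg]) hval
  have htest : (equ (digitExpr (get aA (var vI) *
      get aB (var vI % var vN * var vN + var vI / var vN)) (var vBest)) (var vH)).val s' =
      if edgeCoeff w ω best i j = 0 then 1 else 0 := by
    rw [val_equ, hdigit, val_var, hs'.h_eq, edgeCoeff]
    simp
  refine Run.cond (fun ht => ?_) fun ht => ?_
  · have h0 : edgeCoeff w ω best i j = 0 := by
      by_contra h0
      simp [htest, h0] at ht
    refine Run.skip ⟨τ, by simpa [HoldsPerm] using h1, fun σ hσ x hx => ?_⟩
    rcases Nat.lt_succ_iff_lt_or_eq.1 hx with h | h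
    · exact h2 σ hσ x h
    · obtain ⟨rfl, hj⟩ := edgeIdx_inj h
      exact absurd h0 ((hσ x j).2 hj)
  · have h0 : edgeCoeff w ω best i j ≠ 0 := by
      intro h0
      simp [htest, h0] at ht
    refine (run_swap b2 hN hs'.n_eq hi h1).mono fun s'' _ _ ⟨ρ, h3, h4, h5⟩ =>
      ⟨ρ, by simpa [HoldsPerm] using h3, fun σ hσ x hx => ?_⟩
    have hσi := (hσ i j).1 h0
    by_cases hxi : x = i
    · rw [hxi, h4, hσi]
    · have hlt : edgeIdx x (σ x) < edgeIdx i j :=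
        lt_of_le_of_ne (Nat.lt_succ_iff.1 hx) fun h => hxi (edgeIdx_inj h).1
      have hτ := h2 σ hσ x hlt
      rw [h5 x hxi, hτ]
      rw [hτ, ← hσi]
      exact fun h => hxi (σ.injective h)

end Runs

/-! ### Perfect matchings and permutations -/

section Matchings

variable {d n : ℕ}

/-- The perfect matching given by a permutation. -/
def graph (σ : Equiv.Perm (Fin n)) : Finset (Fin n × Fin n) :=
  Finset.univ.filter fun e => σ e.1 = e.2

theorem mem_graph {σ : Equiv.Perm (Fin n)} {i j : Fin n} : (i, j) ∈ graph σ ↔ σ i = j := by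
  simp [graph]

theorem isPerfectMatching_graph (σ : Equiv.Perm (Fin n)) : IsPerfectMatching (graph σ) := by
  refine ⟨fun i => ⟨σ i, mem_graph.2 rfl, fun j hj => (mem_graph.1 hj).symm⟩,
    fun j => ⟨σ.symm j, mem_graph.2 (by simp), fun i hi => ?_⟩⟩
  rw [← mem_graph.1 hi, Equiv.symm_apply_apply]

theorem IsPerfectMatching.exists_graph {M : Finset (Fin n × Fin n)} (h : IsPerfectMatching M) :
    ∃ σ : Equiv.Perm (Fin n), M = graph σ := by
  choose g hg hg' using h.1
  have hinj : Function.Injective g := fun i i' hii =>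
    (h.2 (g i)).unique (hg i) (by rw [hii]; exact hg i')
  refine ⟨Equiv.ofBijective g (Finite.injective_iff_bijective.1 hinj), ?_⟩
  ext ⟨i, j⟩
  rw [mem_graph, Equiv.ofBijective_apply]
  exact ⟨fun hm => (hg' i j hm).symm, by rintro rfl; exact hg i⟩

theorem weight_graph (w : Fin d → Fin n → Fin n → ℤ) (σ : Equiv.Perm (Fin n)) :
    weight w (graph σ) = decode w (permVec w σ) := by
  rw [decode_permVec]
  funext k
  rw [weight, graph, Finset.sum_filter, Fintype.sum_prod_type]
  simp

theorem HoldsPerm.output_eq {s : State} {τ : Equiv.Perm (Fin n)} (h : HoldsPerm s τ) :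
    s.output n = graph τ := by
  ext ⟨i, j⟩
  rw [mem_graph]
  simp only [State.output, Finset.mem_filter, Finset.mem_univ, true_and, h i, Nat.cast_inj,
    Fin.ext_iff]

theorem isOptimal_graph {goal : Goal} {w : Fin d → Fin n → Fin n → ℤ} {f : (Fin d → ℝ) → ℝ}
    {σ : Equiv.Perm (Fin n)} (h : ∀ τ, goalVal goal f (decode w (permVec w τ)) ≤
      goalVal goal f (decode w (permVec w σ))) : IsOptimal goal w f (graph σ) := by
  refine ⟨isPerfectMatching_graph σ, fun M hM => ?_⟩
  obtain ⟨τ, rfl⟩ := hM.exists_graph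
  have := h τ
  cases goal with
  | maximize => simpa only [weight_graph, goalVal] using this
  | minimize => simpa only [weight_graph, goalVal, neg_le_neg_iff] using this

end Matchings

section Main

variable {d n : ℕ} {w : Fin d → Fin n → Fin n → ℤ}

/-- If among the optimal perfect matchings with the least encoded weight vector `v` the one of
least random weight is unique, then its code is the first maximum found by the search, and it is
the only perfect matching with this code. -/
theorem exists_family (hn : 0 < n) (goal : Goal) (f : (Fin d → ℝ) → ℝ) :
    ∃ F : Finset (Equiv.Perm (Fin n)), F.Nonempty ∧ ∀ ω, Isolating F (randWeight ω (numBits n)) →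
      ∃ σ : Equiv.Perm (Fin n), IsOptimal goal w f (graph σ) ∧
        (∀ τ, permCode w ω τ = permCode w ω σ → τ = σ) ∧
        ∀ flag best, SearchInv (detCoeff w ω)
          (fun c => goalVal goal f (decode w (c / scale n))) (codeBound w) flag best →
            best = permCode w ω σ := by
  classical
  set g : Equiv.Perm (Fin n) → ℝ := fun σ => goalVal goal f (decode w (permVec w σ)) with hg
  obtain ⟨σ₁, -, h₁⟩ := Finset.exists_max_image Finset.univ g ⟨1, Finset.mem_univ _⟩
  obtain ⟨σ₀, h₀, hmin⟩ := Finset.exists_min_image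
    (Finset.univ.filter fun σ => g σ = g σ₁) (permVec w) ⟨σ₁, by simp⟩
  have hmax : ∀ τ, g τ ≤ g σ₀ := fun τ => by
    rw [(Finset.mem_filter.1 h₀).2]; exact h₁ τ (Finset.mem_univ _)
  refine ⟨Finset.univ.filter fun σ => permVec w σ = permVec w σ₀, ⟨σ₀, by simp⟩, fun ω hiso => ?_⟩
  obtain ⟨σ, hσ, hlt⟩ := hiso
  simp only [Finset.mem_filter, Finset.mem_univ, true_and] at hσ hlt
  have hgσ : g σ = g σ₀ := by simp only [hg, hσ]
  have huniq : ∀ τ, permCode w ω τ = permCode w ω σ → τ = σ := by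
    intro τ hτ
    by_contra hne
    have hv : permVec w τ = permVec w σ := by
      rw [← permCode_div hn ω τ, hτ, permCode_div hn]
    have := hlt τ (hv.trans hσ) hne
    rw [permCode_eq, permCode_eq, hv] at hτ
    omega
  refine ⟨σ, isOptimal_graph fun τ => (hmax τ).trans hgσ.ge, huniq, fun flag best hinv => ?_⟩
  have hG : ∀ τ, goalVal goal f (decode w (permCode w ω τ / scale n)) = g τ := fun τ => by
    rw [permCode_div hn]
  refine hinv.eq_first_max (permCode_lt hn ω σ) (detCoeff_ne_zero huniq) ?_ ?_
  · intro c hc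
    obtain ⟨τ, rfl⟩ := exists_of_detCoeff_ne_zero hc
    simp only [hG]
    exact (hmax τ).trans hgσ.ge
  · intro c hlt' hc
    obtain ⟨τ, rfl⟩ := exists_of_detCoeff_ne_zero hc
    simp only [hG]
    refine lt_of_le_of_ne ((hmax τ).trans hgσ.ge) fun heq => ?_
    have h2 : permVec w σ₀ ≤ permVec w τ := hmin τ (by
      simp only [Finset.mem_filter, Finset.mem_univ, true_and]
      rw [heq, hgσ, (Finset.mem_filter.1 h₀).2])
    have h3 : permVec w τ ≤ permVec w σ := by
      rw [← permCode_div hn ω τ, ← permCode_div hn ω σ]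
      exact Nat.div_le_div_right hlt'.le
    have h4 : permVec w τ = permVec w σ₀ := by omega
    have h5 := hlt τ h4 (by rintro rfl; exact lt_irrefl _ hlt')
    rw [permCode_eq, permCode_eq, h4, hσ] at hlt'
    omega

theorem bdd_input (hd : 0 < d) (hn : 0 < n) : Bdd (valueBound w) (input w) := by
  obtain ⟨b1, b2, b3, b4, b5, b6, b7⟩ := le_iterBound (w := w) hd hn
  have hN := iterBound_le (w := w)
  have hC := codeBound_le_iterBound (w := w)
  have hbase := base_le (w := w) hd hn
  have hW := sumSq_lt_base (w := w) hn
  have h0 : |(0 : ℤ)| ≤ (valueBound w : ℤ) := by simp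
  constructor
  · intro x
    simp only [input]
    split_ifs
    · rw [Nat.abs_cast, Nat.cast_le]; omega
    · exact h0
  · intro a p
    by_cases ha : a = 0
    · subst ha
      by_cases hp : ∃ q : Fin d × Fin n × Fin n, p = (position q : ℤ)
      · obtain ⟨⟨k, i, j⟩, rfl⟩ := hp
        rw [input_arr]
        exact (abs_le_sumSq k i j).trans (by exact_mod_cast (by omega))
      · push Not at hp
        simp [input, hp]
    · simp [input, ha]

/-- The algorithm halts in time, always outputs a perfect matching, and the output is optimal if
the random weights are isolating. -/
theorem run_matching (hd : 0 < d) (hn : 0 < n) (goal : Goal) (f : (Fin d → ℝ) → ℝ) :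
    ∃ F : Finset (Equiv.Perm (Fin n)), F.Nonempty ∧ ∀ ω,
      Run (comparisonOracle f) ω (iterBound w) (valueBound w) (matchingProg d goal) (input w)
        fun s => IsPerfectMatching (s.output n) ∧
          (Isolating F (randWeight ω (numBits n)) → IsOptimal goal w f (s.output n)) := by
  obtain ⟨F, hF, hfam⟩ := exists_family (w := w) hn goal f
  refine ⟨F, hF, fun ω => ?_⟩
  obtain ⟨b1, b2, b3, b4, b5, b6, b7⟩ := le_iterBound (w := w) hd hn
  have hN := iterBound_le (w := w)
  refine Run.seq ((run_setup hd hn).mono fun s₁ _ _ ⟨S₁, h1, h2⟩ => ?_)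
  refine Run.seq ((run_matrix hd hn S₁ h1).mono fun s₂ f₂ _ h3 => ?_)
  have S₂ := S₁.frame f₂ rfl
  set A : Matrix (Fin n) (Fin n) ℤ :=
    Matrix.of fun i j => (bigBase n : ℤ) ^ edgeCode w ω i j with hA
  have hK1 : (1 : ℤ) ≤ bigBase n := by
    unfold bigBase; push_cast; linarith [pow_nonneg (Nat.cast_nonneg (α := ℤ) n) n]
  have ha : (1 : ℤ) ≤ (bigBase n : ℤ) ^ codeBound w := one_le_pow₀ hK1
  have hAa : ∀ i j, |A i j| ≤ (bigBase n : ℤ) ^ codeBound w := fun i j => by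
    rw [hA, Matrix.of_apply, abs_of_nonneg (by positivity)]
    exact pow_le_pow_right₀ hK1 (edgeCode_lt ω i j).le
  have hR : (2 * n ^ 3 * ((bigBase n : ℤ) ^ codeBound w) ^ 2) ^ (n + 1) ≤ (valueBound w : ℤ) := by
    have : (2 * n ^ 3 * (bigBase n ^ codeBound w) ^ 2) ^ (n + 1) ≤ valueBound w :=
      Nat.le_add_left _ _
    exact_mod_cast this
  refine Run.seq ((run_adjugate ha hAa hn b3 hN hR S₂.n_eq S₂.nn_eq h3
    (by rw [f₂.arr rfl]; exact h2)).mono fun s₃ f₃ _ ⟨h4, h5⟩ => ?_)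
  have S₃ := S₂.frame f₃ rfl
  rw [hA, charpoly_coeff_zero_pow] at h5
  refine Run.seq ((run_search hd hn goal f S₃ h5).mono fun s₄ f₄ _ ⟨flag, best, h6, h7⟩ => ?_)
  have S₄ := S₃.frame f₄ (by cases goal <;> rfl)
  have hbest := h7.best_lt (codeBound_pos hn) le_rfl
  refine (run_output (ω := ω) hd hn S₄ hbest h6 fun i j => ?_).mono fun s₅ _ _ ⟨τ, h8, h9⟩ => ?_
  · rw [f₄.arr (by cases goal <;> rfl), f₄.arr (by cases goal <;> rfl), h4, f₃.arr rfl, h3, hA]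
    exact mul_adjCoeff_zero_pow _ _ i j
  · rw [h8.output_eq]
    refine ⟨isPerfectMatching_graph τ, fun hiso => ?_⟩
    obtain ⟨σ, hopt, huniq, hsearch⟩ := hfam ω hiso
    rw [hsearch flag best h7] at h9
    rw [h9 σ (edgeCoeff_ne_zero_iff huniq)]
    exact hopt

/-! ### The running time -/

theorem Prog.steps_mono (P : Prog) {N N' : ℕ} (h : N ≤ N') : P.steps d N ≤ P.steps d N' := by
  induction P with
  | skip | assign | store | toss | query => exact le_rfl
  | seq P Q hP hQ | cond c P Q hP hQ => simp only [Prog.steps]; omega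
  | loop c P hP =>
    simp only [Prog.steps]
    exact Nat.mul_le_mul (by omega) (by omega)

theorem abs_weight_le (k : Fin d) (i j : Fin n) : (w k i j).natAbs ≤ maxAbs w :=
  Finset.le_sup (f := fun q : Fin d × Fin n × Fin n => (w q.1 q.2.1 q.2.2).natAbs)
    (Finset.mem_univ (k, i, j))

theorem natAbs_input_le (p : ℤ) : ((input w).arr 0 p).natAbs ≤ maxAbs w := by
  by_cases hp : ∃ q : Fin d × Fin n × Fin n, p = (position q : ℤ)
  · obtain ⟨⟨k, i, j⟩, rfl⟩ := hp
    rw [input_arr]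
    exact abs_weight_le k i j
  · push Not at hp
    simp [input, hp]

theorem sumSq_le : sumSq w ≤ d * (n * n) * maxAbs w ^ 2 := by
  have := Finset.sum_le_card_nsmul (Finset.range (d * (n * n)))
    (fun p : ℕ => ((input w).arr 0 p).natAbs ^ 2) (maxAbs w ^ 2)
    fun p _ => Nat.pow_le_pow_left (natAbs_input_le _) 2
  simpa [sumSq] using this

/-- A polynomial bound for the number of iterations of every loop. -/
def iterPoly (d n m : ℕ) : ℕ :=
  d * (n * n) + 2 * n + n * (4 * (n * n)) * (2 * n * (d * (n * n) * m ^ 2) + 1) ^ d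

theorem iterBound_le_iterPoly (hn : 0 < n) : iterBound w ≤ iterPoly d n (maxAbs w) := by
  have h1 : base w ≤ 2 * n * (d * (n * n) * maxAbs w ^ 2) + 1 :=
    Nat.add_le_add_right (Nat.mul_le_mul_left _ sumSq_le) 1
  have h2 : codeBound w ≤ n * (4 * (n * n)) * (2 * n * (d * (n * n) * maxAbs w ^ 2) + 1) ^ d :=
    Nat.mul_le_mul (Nat.mul_le_mul_left _ (two_pow_numBits_le hn)) (Nat.pow_le_pow_left h1 d)
  exact Nat.add_le_add_left h2 _

theorem nat_size_bigBase_le (n : ℕ) : Nat.size (bigBase n) ≤ n * n + 5 := by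
  have h1 := nat_size_add_le (2 * n ^ n) 1
  have h2 := nat_size_mul_le 2 (n ^ n)
  have h3 := nat_size_pow_le n n
  have h4 := Nat.mul_le_mul_left n (nat_size_le_self n)
  have h5 := nat_size_le_self 2
  have h6 := nat_size_le_self 1
  unfold bigBase
  omega

/-- A polynomial bound for the size of all numbers that the program stores. -/
def sizePoly (d n m : ℕ) : ℕ :=
  iterPoly d n m + (n + 1) * (2 * n ^ 3 + (2 * (iterPoly d n m * (n * n + 5) + 1) + 1)) + 3

theorem size_valueBound_le (hn : 0 < n) :
    size (valueBound w : ℤ) ≤ sizePoly d n (maxAbs w) := by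
  have hN := iterBound_le_iterPoly (w := w) hn
  have hC := codeBound_le_iterBound (w := w)
  set y := bigBase n ^ codeBound w with hy
  have h1 := nat_size_add_le (iterBound w) ((2 * n ^ 3 * y ^ 2) ^ (n + 1))
  have h2 := nat_size_le_self (iterBound w)
  have h3 := nat_size_pow_le (2 * n ^ 3 * y ^ 2) (n + 1)
  have h4 := nat_size_mul_le (2 * n ^ 3) (y ^ 2)
  have h5 := nat_size_le_self (2 * n ^ 3)
  have h6 := nat_size_pow_le y 2
  have h7 : Nat.size y ≤ iterPoly d n (maxAbs w) * (n * n + 5) + 1 :=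
    (nat_size_pow_le _ _).trans (Nat.add_le_add_right
      (Nat.mul_le_mul (hC.trans hN) (nat_size_bigBase_le n)) 1)
  have h8 : (n + 1) * Nat.size (2 * n ^ 3 * y ^ 2) ≤ (n + 1) *
      (2 * n ^ 3 + (2 * (iterPoly d n (maxAbs w) * (n * n + 5) + 1) + 1)) :=
    Nat.mul_le_mul_left _ (by omega)
  rw [size, Int.natAbs_natCast, valueBound, ← hy, sizePoly]
  omega

theorem polyBdd_iterPoly (d : ℕ) : PolyBdd (iterPoly d) := by
  have hnn : PolyBdd fun n _ => n * n := PolyBdd.fst.mul PolyBdd.fst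
  exact (((PolyBdd.const d).mul hnn).add ((PolyBdd.const 2).mul .fst)).add
    ((PolyBdd.fst.mul ((PolyBdd.const 4).mul hnn)).mul
      (((((PolyBdd.const 2).mul .fst).mul
        (((PolyBdd.const d).mul hnn).mul (PolyBdd.snd.pow 2))).add (.const 1)).pow d))

theorem polyBdd_sizePoly (d : ℕ) : PolyBdd (sizePoly d) := by
  have hnn : PolyBdd fun n _ => n * n := PolyBdd.fst.mul PolyBdd.fst
  have hN := polyBdd_iterPoly d
  exact (hN.add ((PolyBdd.fst.add (.const 1)).mul (((PolyBdd.const 2).mul (PolyBdd.fst.pow 3)).add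
    (((PolyBdd.const 2).mul ((hN.mul (hnn.add (.const 5))).add (.const 1))).add (.const 1))))).add
      (.const 3)

end Main

end NonlinearMatching

theorem theorem1p2 (d : ℕ) (hd : 0 < d) (goal : Goal) :
    ∃ (P : Prog) (p : MvPolynomial (Fin 2) ℕ),
      ∀ (n : ℕ) (_hn : 0 < n) (w : Fin d → Fin n → Fin n → ℤ) (f : (Fin d → ℝ) → ℝ),
        (∀ ω : ℕ → Bool, ∃ (t : ℕ) (s : State),
          Exec (comparisonOracle f) ω P (input w) t s ∧
          t ≤ MvPolynomial.eval ![n, maxAbs w] p ∧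
          IsPerfectMatching (s.output n)) ∧
        1 / 2 ≤ coinMeasure {ω : ℕ → Bool | ∃ (t : ℕ) (s : State),
          Exec (comparisonOracle f) ω P (input w) t s ∧
          IsOptimal goal w f (s.output n)} := by
  obtain ⟨p, hp⟩ := ((polyBdd_iterPoly d).steps d (matchingProg d goal)).mul (polyBdd_sizePoly d)
  refine ⟨matchingProg d goal, p, fun n hn w f => ?_⟩
  obtain ⟨F, hF, hrun⟩ := run_matching (w := w) hd hn goal f
  refine ⟨fun ω => ?_, (half_le_isolating hF hn (le_two_pow_numBits n)).trans
    (MeasureTheory.measure_mono fun ω hω => ?_)⟩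
  · obtain ⟨t, s, he, ht, -, hs, -⟩ := hrun ω (bdd_input hd hn)
    refine ⟨t, s, he, ht.trans (le_trans ?_ (hp n (maxAbs w))), hs⟩
    exact Nat.mul_le_mul (Prog.steps_mono _ (iterBound_le_iterPoly hn)) (size_valueBound_le hn)
  · obtain ⟨t, s, he, -, -, -, hs⟩ := hrun ω (bdd_input hd hn)
    exact ⟨t, s, he, hs hω⟩
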